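/- Let $\Gamma$ be a discrete group acting by measure preserving transformations on a probability space $(X,\mu)$, let $\pi\colon\Gamma\to O(H)$ be an orthogonal representation on a real Hilbert space $H$ with a countable orthonormal basis $(e_n)_{n\in I}$, and let $b\colon\Gamma\to H$ be a 1-cocycle, i.e. $b(gh)=\pi(g)b(h)+b(g)$ for all $g,h\in\Gamma$. Let $(Z,\nu)=\prod_{n\in I}\bigl(\mathbb R,\tfrac1{\sqrt{2\pi}}e^{-s^2/2}\,ds\bigr)$. For $\xi=\sum_n c_ne_n\in H$ let $\omega(\xi)\in\mathcal U(L^\infty(Z))$ be the unitary $z\mapsto\exp\bigl(\sqrt2\,i\sum_n c_nz_n\bigr)$, where the series $\sum_n c_nz_n$ converges in $L^2(Z,\nu)$. Let $D\subseteq L^\infty(Z)$ be the von Neumann algebra generated by all $\omega(\xi)$, $\xi\in H$, with the trace preserving (Gaussian) action of $\Gamma$ determined by $g\cdot\omega(\xi)=\omega(\pi(g)\xi)$. Let $A=L^\infty(X)$ with the induced action of $\Gamma$, let $\tilde M=(D\bar\otimes A)\rtimes\Gamma$ be the crossed product by the diagonal action, with canonical unitaries $(u_g)_{g\in\Gamma}$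 and canonical trace $\tau_{\tilde M}$, and let $M=(1\otimes A)\rtimes\Gamma\subseteq\tilde M$ (a copy of $A\rtimes\Gamma$). Let $\|y\|_2=\tau_{\tilde M}(y^*y)^{1/2}$, and let $E_M\colon\tilde M\to M$ be the trace preserving conditional expectation, i.e. $E_M(y)$ is the unique element of $M$ with $\tau_{\tilde M}(E_M(y)z)=\tau_{\tilde M}(yz)$ for all $z\in M$. For $t\in\mathbb R$ let $\alpha_t$ be the normal $*$-automorphism of $\tilde M$ that is the identity on $D\bar\otimes A$ and satisfies $\alpha_t(u_g)=(\omega(tb(g))\otimes1)u_g$ for all $g\in\Gamma$. Then for every $t\in\mathbb R$ and every $x\in M$ the number $\tau_{\tilde M}(\alpha_t(x)x^*)$ is real and $$\tau_{\tilde M}(\alpha_t(x)x^*)\ \ge\ \|E_M(\alpha_t(x))\|_2^2 .$$ -/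

import Mathlib

namespace CocycleDeformation

open MeasureTheory ProbabilityTheory Complex
open scoped ENNReal NNReal


section Gaussian

/-- The measure `ν` on `Z = ℝ^ι`: the product of standard Gaussian measures. -/
noncomputable def gaussMeasure (ι : Type*) : Measure (ι → ℝ) :=
  Measure.infinitePi fun _ : ι => gaussianReal 0 1

instance (ι : Type*) : IsProbabilityMeasure (gaussMeasure ι) := by
  unfold gaussMeasure; infer_instance

variable {ι H : Type*} [NormedAddCommGroup H] [InnerProductSpace ℝ H]

theorem map_coord (i : ι) : (gaussMeasure ι).map (fun z => z i) = gaussianReal 0 1 :=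
  Measure.infinitePi_map_eval _ i

theorem memLp_coord (i : ι) : MemLp (fun z : ι → ℝ => z i) 2 (gaussMeasure ι) := by
  have h : MemLp (id : ℝ → ℝ) 2 ((gaussMeasure ι).map (fun z => z i)) := by
    rw [map_coord]; exact memLp_id_gaussianReal 2
  exact h.comp_of_map (measurable_pi_apply i).aemeasurable

/-- The `i`-th coordinate function `z ↦ z i`, as an element of `L²(Z, ν)`; these are orthonormal. -/
noncomputable def coord (i : ι) : Lp ℝ 2 (gaussMeasure ι) := (memLp_coord i).toLp _

theorem coord_ae (i : ι) : coord i =ᵐ[gaussMeasure ι] fun z => z i := MemLp.coeFn_toLp _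

theorem iIndepFun_coord : iIndepFun (fun (i : ι) (z : ι → ℝ) => z i) (gaussMeasure ι) :=
  iIndepFun_infinitePi (X := fun _ x => x) (fun _ => measurable_id)

theorem orthonormal_coord : Orthonormal ℝ (coord : ι → Lp ℝ 2 (gaussMeasure ι)) := by
  classical
  rw [orthonormal_iff_ite]
  intro i j
  have h1 : inner ℝ (coord i) (coord j) = ∫ z, z i * z j ∂(gaussMeasure ι) := by
    rw [L2.inner_def]
    refine integral_congr_ae ?_
    filter_upwards [coord_ae i, coord_ae j] with z hi hj
    simp [hi, hj, mul_comm]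
  have hm : ∀ i : ι, ∫ z, z i ∂(gaussMeasure ι) = 0 := fun i => by
    have := integral_map (μ := gaussMeasure ι) (φ := fun z => z i) (f := fun x : ℝ => x)
      (measurable_pi_apply i).aemeasurable (by fun_prop)
    rw [← this, map_coord]; exact integral_id_gaussianReal
  rw [h1]
  split_ifs with hij
  · subst hij
    have := integral_map (μ := gaussMeasure ι) (φ := fun z => z i) (f := fun x : ℝ => x * x)
      (measurable_pi_apply i).aemeasurable (by fun_prop)
    rw [← this, map_coord]
    have hv := variance_eq_sub (X := id) (μ := gaussianReal 0 1) (memLp_id_gaussianReal 2)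
    rw [variance_id_gaussianReal] at hv
    simp [integral_id_gaussianReal, pow_two] at hv
    exact hv.symm
  · have := (iIndepFun_coord.indepFun hij).integral_fun_mul_eq_mul_integral
      (measurable_pi_apply i).aestronglyMeasurable (measurable_pi_apply j).aestronglyMeasurable
    rw [this, hm, zero_mul]

/-- The isometric linear map `H → L²(Z, ν; ℝ)` with `∑ cᵢ eᵢ ↦ ∑ cᵢ zᵢ`. On the span of the basis
the sum is finite; a general vector is reached by continuity (the series converges in `L²`). -/
noncomputable def gaussField (e : HilbertBasis ι ℝ H) : H →ₗᵢ[ℝ] Lp ℝ 2 (gaussMeasure ι) :=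
  orthonormal_coord.orthogonalFamily.linearIsometry.comp e.repr.toLinearIsometry

theorem hasSum_gaussField (e : HilbertBasis ι ℝ H) (ξ : H) :
    HasSum (fun i => e.repr ξ i • coord i) (gaussField e ξ) :=
  orthonormal_coord.orthogonalFamily.hasSum_linearIsometry (e.repr ξ)

theorem gaussField_basis (e : HilbertBasis ι ℝ H) (i : ι) : gaussField e (e i) = coord i := by
  classical
  have h1 : e.repr (e i) = lp.single 2 i (1 : ℝ) := by simp [e.repr_self]
  have h2 := orthonormal_coord.orthogonalFamily.linearIsometry_apply_single (i := i) (1 : ℝ)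
  change orthonormal_coord.orthogonalFamily.linearIsometry (e.repr (e i)) = coord i
  rw [h1]
  refine h2.trans ?_
  simp

theorem integral_exp_gaussField (e : HilbertBasis ι ℝ H) (ξ : H) :
    ∫ z, exp (I * (gaussField e ξ z : ℝ)) ∂(gaussMeasure ι) = Real.exp (-‖ξ‖ ^ 2 / 2) := by
  have hb : ∀ f : Lp ℝ 2 (gaussMeasure ι),
      Integrable (fun z => exp (I * (f z : ℝ))) (gaussMeasure ι) := fun f => by
    refine Integrable.of_bound (C := 1) ?_ ?_
    · have := Lp.aestronglyMeasurable f
      have h2 : Continuous fun x : ℝ => exp (I * (x : ℂ)) := by fun_prop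
      exact h2.comp_aestronglyMeasurable this
    · filter_upwards with z
      rw [mul_comm, norm_exp_ofReal_mul_I]
  have hcont : Continuous fun f : Lp ℝ 2 (gaussMeasure ι) =>
      ∫ z, exp (I * (f z : ℝ)) ∂(gaussMeasure ι) := by
    refine LipschitzWith.continuous (K := 1) (LipschitzWith.of_dist_le_mul fun f g => ?_)
    rw [dist_eq_norm, dist_eq_norm, ← integral_sub (hb f) (hb g), NNReal.coe_one, one_mul]
    have hfg : Integrable (f - g : Lp ℝ 2 (gaussMeasure ι)) (gaussMeasure ι) :=
      (Lp.memLp (f - g)).integrable (by norm_num)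
    calc _ ≤ ∫ z, ‖(f - g : Lp ℝ 2 (gaussMeasure ι)) z‖ ∂(gaussMeasure ι) := by
          refine norm_integral_le_of_norm_le hfg.norm ?_
          filter_upwards [Lp.coeFn_sub f g] with z hz
          rw [hz, Pi.sub_apply]
          have : exp (I * (f z : ℝ)) - exp (I * (g z : ℝ))
              = exp ((g z : ℝ) * I) * (exp (I * ((f z - g z : ℝ) : ℂ)) - 1) := by
            rw [mul_sub, ← exp_add]; push_cast; ring_nf
          rw [this, norm_mul, norm_exp_ofReal_mul_I, one_mul]
          exact Real.norm_exp_I_mul_ofReal_sub_one_le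
      _ ≤ ‖f - g‖ := by
          rw [Lp.norm_def, integral_norm_eq_lintegral_enorm hfg.1, ← eLpNorm_one_eq_lintegral_enorm]
          exact ENNReal.toReal_mono (Lp.memLp _).2.ne
            (eLpNorm_le_eLpNorm_of_exponent_le (by norm_num) hfg.1)
  have hfin : ∀ s : Finset ι, ∫ z, exp (I * ((∑ i ∈ s, e.repr ξ i • coord i :
      Lp ℝ 2 (gaussMeasure ι)) z : ℝ)) ∂(gaussMeasure ι)
      = exp (((-(∑ i ∈ s, ‖e.repr ξ i‖ ^ 2) / 2 : ℝ)) : ℂ) := fun s => by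
    have hae : (∑ i ∈ s, e.repr ξ i • coord i : Lp ℝ 2 (gaussMeasure ι))
        =ᵐ[gaussMeasure ι] fun z => ∑ i ∈ s, e.repr ξ i * z i := by
      classical
      induction s using Finset.induction_on with
      | empty =>
        simp only [Finset.sum_empty]
        exact Lp.coeFn_zero ℝ 2 (gaussMeasure ι)
      | insert a s ha ih =>
        rw [Finset.sum_insert ha]
        filter_upwards [Lp.coeFn_add (e.repr ξ a • coord a) (∑ i ∈ s, e.repr ξ i • coord i),
          Lp.coeFn_smul (e.repr ξ a) (coord a : Lp ℝ 2 (gaussMeasure ι)), coord_ae a, ih]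
          with z h1 h2 h3 h4
        rw [h1, Pi.add_apply, h2, Pi.smul_apply, h3, h4, Finset.sum_insert ha, smul_eq_mul]
    have hind : iIndepFun (fun (i : ι) (z : ι → ℝ) => e.repr ξ i * z i) (gaussMeasure ι) :=
      iIndepFun_coord.comp (fun i x => e.repr ξ i * x) (fun i => by fun_prop)
    have hmeas : ∀ i, Measurable fun z : ι → ℝ => e.repr ξ i * z i :=
      fun i => (measurable_pi_apply i).const_mul _
    have hch := congrFun ((hind.restrict s).charFun_map_fun_finsetSum_eq_prod
      (fun i _ => (hmeas i).aemeasurable)) 1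
    rw [charFun_apply_real, integral_map (Finset.measurable_sum s fun i _ => hmeas i).aemeasurable
      (by fun_prop), Finset.prod_apply] at hch
    have hone : ∀ i, charFun ((gaussMeasure ι).map fun z => e.repr ξ i * z i) 1
        = exp (((-(‖e.repr ξ i‖ ^ 2) / 2 : ℝ)) : ℂ) := fun i => by
      have h := charFun_gaussianReal (μ := 0) (v := 1) (e.repr ξ i)
      rw [← map_coord i, charFun_apply_real, integral_map
        (measurable_pi_apply i).aemeasurable (by fun_prop)] at h
      rw [charFun_apply_real, integral_map (hmeas i).aemeasurable (by fun_prop)]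
      have h' : ∀ z : ι → ℝ, exp (((1 : ℝ) : ℂ) * ((e.repr ξ i * z i : ℝ) : ℂ) * I)
          = exp ((e.repr ξ i : ℂ) * (z i : ℂ) * I) := fun z => by push_cast; ring_nf
      simp_rw [h']
      rw [h, Real.norm_eq_abs, sq_abs]
      push_cast
      ring_nf
    simp_rw [hone] at hch
    rw [← exp_sum] at hch
    rw [integral_congr_ae (g := fun z => exp (((1 : ℝ) : ℂ) * ((∑ i ∈ s, e.repr ξ i * z i : ℝ) : ℂ)
      * I)), hch]
    · congr 1
      push_cast
      rw [neg_div, Finset.sum_div, ← Finset.sum_neg_distrib]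
      simp [neg_div]
    · filter_upwards [hae] with z hz
      rw [hz]; push_cast; ring_nf
  have ht1 := (hcont.tendsto (gaussField e ξ)).comp (hasSum_gaussField e ξ)
  have ht2 : HasSum (fun i => ‖e.repr ξ i‖ ^ 2) (‖ξ‖ ^ 2) := by
    have := lp.hasSum_norm (by norm_num) (e.repr ξ)
    simpa using this
  have hc2 : Continuous fun r : ℝ => exp (((-r / 2 : ℝ)) : ℂ) := by fun_prop
  have ht3 := (hc2.tendsto (‖ξ‖ ^ 2)).comp ht2
  refine (tendsto_nhds_unique ht1 (ht3.congr fun s => (hfin s).symm)).trans ?_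
  push_cast
  rfl

theorem map_gaussField (e : HilbertBasis ι ℝ H) {ξ : H} (hξ : ‖ξ‖ = 1) :
    (gaussMeasure ι).map (gaussField e ξ) = gaussianReal 0 1 := by
  have hm := (Lp.aestronglyMeasurable (gaussField e ξ)).aemeasurable
  have : IsProbabilityMeasure ((gaussMeasure ι).map (gaussField e ξ)) :=
    Measure.isProbabilityMeasure_map hm
  refine Measure.ext_of_charFun (funext fun t => ?_)
  rw [charFun_gaussianReal, charFun_apply_real, integral_map hm (by fun_prop)]
  have h := integral_exp_gaussField e (t • ξ)
  rw [integral_congr_ae (g := fun z => exp ((t : ℂ) * (gaussField e ξ z : ℝ) * I))] at h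
  · rw [h, norm_smul, hξ]
    simp
    congr 1; ring_nf
  · rw [map_smul]
    filter_upwards [Lp.coeFn_smul t (gaussField e ξ)] with z hz
    rw [hz]; simp; ring_nf

theorem iIndepFun_gaussField (e : HilbertBasis ι ℝ H) {κ : Type*} {f : κ → H}
    (hf : Orthonormal ℝ f) :
    iIndepFun (fun k => (gaussField e (f k) : (ι → ℝ) → ℝ)) (gaussMeasure ι) := by
  have hm : ∀ ξ, AEMeasurable (gaussField e ξ) (gaussMeasure ι) :=
    fun ξ => (Lp.aestronglyMeasurable (gaussField e ξ)).aemeasurable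
  rw [iIndepFun_iff_finset]
  intro s
  refine (iIndepFun_iff_charFun_pi fun k => hm _).2 fun t => ?_
  have hX : ∀ k : s, charFun ((gaussMeasure ι).map
      (s.restrict (fun k => (gaussField e (f k) : (ι → ℝ) → ℝ)) k)) (t k)
      = exp ((-(t k ^ 2) / 2 : ℝ) : ℂ) := fun k => by
    rw [Finset.restrict, map_gaussField e (hf.norm_eq_one k), charFun_gaussianReal]
    congr 1
    push_cast
    ring
  refine Eq.trans ?_ (Finset.prod_congr rfl fun k _ => (hX k).symm)
  have hm2 : AEMeasurable (fun z => WithLp.toLp 2 fun k : s => (gaussField e (f k) : (ι → ℝ) → ℝ) z)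
      (gaussMeasure ι) :=
    (WithLp.measurable_toLp 2 (s → ℝ)).comp_aemeasurable (aemeasurable_pi_lambda _ fun k => hm _)
  rw [charFun_apply, integral_map hm2 (by fun_prop), ← exp_sum]
  have h := integral_exp_gaussField e (∑ k : s, t k • f k)
  have hae : (gaussField e (∑ k : s, t k • f k) : (ι → ℝ) → ℝ)
      =ᵐ[gaussMeasure ι] fun z => ∑ k : s, t k * gaussField e (f k) z := by
    rw [map_sum]
    simp_rw [map_smul]
    filter_upwards [Lp.coeFn_fun_finsetSum Finset.univ fun k : s => t k • gaussField e (f k),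
      ae_all_iff.2 fun k : s => Lp.coeFn_smul (t k) (gaussField e (f k))] with z h1 h2
    rw [h1]
    exact Finset.sum_congr rfl fun k _ => h2 k
  have hn : ‖∑ k : s, t k • f k‖ ^ 2 = ∑ k : s, t k ^ 2 := by
    have hf' : Orthonormal ℝ fun k : s => f k := hf.comp _ Subtype.val_injective
    rw [← real_inner_self_eq_norm_sq, hf'.inner_sum]
    simp [pow_two]
  rw [hn] at h
  rw [integral_congr_ae (g := fun z => exp (I * (gaussField e (∑ k : s, t k • f k) z : ℝ))), h]
  · rw [ofReal_exp, neg_div, Finset.sum_div, ← Finset.sum_neg_distrib]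
    push_cast
    simp [neg_div]
  · filter_upwards [hae] with z hz
    rw [hz]
    simp [PiLp.inner_apply, mul_comm]

/-- The transformation of `Z` that induces the Gaussian action of an orthogonal operator `V`
on the basis vectors: the `i`-th coordinate of `gaussMap e V z` is the value at `z` of the Gaussian
variable of `V eᵢ`. It preserves `ν`, see `measurePreserving_gaussMap`. -/
noncomputable def gaussMap (e : HilbertBasis ι ℝ H) (V : H ≃ₗᵢ[ℝ] H) (z : ι → ℝ) : ι → ℝ :=
  fun i => gaussField e (V (e i)) z

theorem measurePreserving_gaussMap (e : HilbertBasis ι ℝ H) (V : H ≃ₗᵢ[ℝ] H) :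
    MeasurePreserving (gaussMap e V) (gaussMeasure ι) (gaussMeasure ι) := by
  have ho : Orthonormal ℝ fun i => V (e i) := e.orthonormal.comp_linearIsometryEquiv V
  have hm : ∀ i, Measurable (gaussField e (V (e i)) : (ι → ℝ) → ℝ) :=
    fun i => (Lp.stronglyMeasurable _).measurable
  refine ⟨measurable_pi_lambda _ hm, ?_⟩
  have h := (iIndepFun_gaussField e ho).map_fun_eq_infinitePi_map hm
  simp_rw [map_gaussField e (ho.norm_eq_one _)] at h
  exact h

theorem gaussField_comp_gaussMap (e : HilbertBasis ι ℝ H) (V : H ≃ₗᵢ[ℝ] H) (ξ : H) :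
    (fun z => gaussField e ξ (gaussMap e V z)) =ᵐ[gaussMeasure ι] gaussField e (V ξ) := by
  have hV := measurePreserving_gaussMap e V
  refine (Lp.coeFn_compMeasurePreserving (gaussField e ξ) hV).symm.trans ?_
  suffices h : Lp.compMeasurePreserving (gaussMap e V) hV (gaussField e ξ)
      = gaussField e (V ξ) by rw [h]
  have h1 := (hasSum_gaussField e ξ).mapL
    (Lp.compMeasurePreservingₗᵢ ℝ (gaussMap e V) hV (E := ℝ) (p := 2)).toContinuousLinearMap
  have h2 := (e.hasSum_repr ξ).mapL
    ((gaussField e).toContinuousLinearMap ∘L V.toContinuousLinearEquiv.toContinuousLinearMap)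
  refine h1.unique (h2.congr_fun fun i => ?_)
  have h3 : Lp.compMeasurePreserving (gaussMap e V) hV (coord i) = gaussField e (V (e i)) := by
    apply Lp.ext
    filter_upwards [Lp.coeFn_compMeasurePreserving (coord i) hV,
      hV.quasiMeasurePreserving.ae_eq_comp (coord_ae i)] with z h4 h5
    rw [h4, h5]; rfl
  rw [map_smul, map_smul]
  exact congrArg (e.repr ξ i • ·) h3

theorem gaussMap_mul [Countable ι] (e : HilbertBasis ι ℝ H) (V W : H ≃ₗᵢ[ℝ] H) :
    gaussMap e (V * W) =ᵐ[gaussMeasure ι] gaussMap e W ∘ gaussMap e V := by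
  filter_upwards [ae_all_iff.2 fun i => gaussField_comp_gaussMap e V (W (e i))] with z hz
  funext i
  exact (hz i).symm

theorem gaussMap_one [Countable ι] (e : HilbertBasis ι ℝ H) :
    gaussMap e (1 : H ≃ₗᵢ[ℝ] H) =ᵐ[gaussMeasure ι] id := by
  filter_upwards [ae_all_iff.2 fun i => coord_ae (ι := ι) i] with z hz
  funext i
  change gaussField e (e i) z = z i
  rw [gaussField_basis, hz i]

/-- The function `exp(√2 i ∑ cₙ zₙ)` on `Z`, for `ξ = ∑ cₙ eₙ`. -/
noncomputable def omegaFun (e : HilbertBasis ι ℝ H) (ξ : H) (z : ι → ℝ) : ℂ :=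
  exp ((Real.sqrt 2 : ℂ) * I * (gaussField e ξ z : ℝ))

theorem norm_omegaFun (e : HilbertBasis ι ℝ H) (ξ : H) (z : ι → ℝ) : ‖omegaFun e ξ z‖ = 1 := by
  have : (Real.sqrt 2 : ℂ) * I * (gaussField e ξ z : ℝ)
    = ((Real.sqrt 2 * gaussField e ξ z : ℝ) : ℂ) * I := by push_cast; ring
  rw [omegaFun, this, norm_exp_ofReal_mul_I]

theorem memLp_omegaFun (e : HilbertBasis ι ℝ H) (ξ : H) :
    MemLp (omegaFun e ξ) ∞ (gaussMeasure ι) := by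
  refine memLp_top_of_bound ?_ 1 (Filter.Eventually.of_forall fun z => (norm_omegaFun e ξ z).le)
  have h2 : Continuous fun x : ℝ => exp ((Real.sqrt 2 : ℂ) * I * (x : ℂ)) := by fun_prop
  exact h2.comp_aestronglyMeasurable (Lp.aestronglyMeasurable (gaussField e ξ))

/-- The unitary `ω(ξ)` of `L^∞(Z, ν)`. -/
noncomputable def omega (e : HilbertBasis ι ℝ H) (ξ : H) : Lp ℂ ∞ (gaussMeasure ι) :=
  (memLp_omegaFun e ξ).toLp _

theorem omega_ae (e : HilbertBasis ι ℝ H) (ξ : H) :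
    omega e ξ =ᵐ[gaussMeasure ι] omegaFun e ξ := MemLp.coeFn_toLp _

theorem norm_omega_le (e : HilbertBasis ι ℝ H) (ξ : H) : ‖omega e ξ‖ ≤ 1 := by
  rw [omega, Lp.norm_toLp]
  refine ENNReal.toReal_le_of_le_ofReal zero_le_one ?_
  rw [eLpNorm_exponent_top]
  refine eLpNormEssSup_le_of_ae_bound (Filter.Eventually.of_forall fun z => (norm_omegaFun e ξ z).le)

/-- The transformation `gaussMap e V` induces `ω(ξ) ↦ ω(V ξ)`. -/
theorem omega_comp_gaussMap (e : HilbertBasis ι ℝ H) (V : H ≃ₗᵢ[ℝ] H) (ξ : H) :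
    Lp.compMeasurePreserving (gaussMap e V) (measurePreserving_gaussMap e V) (omega e ξ)
      = omega e (V ξ) := by
  apply Lp.ext
  filter_upwards [Lp.coeFn_compMeasurePreserving (omega e ξ) (measurePreserving_gaussMap e V),
    (measurePreserving_gaussMap e V).quasiMeasurePreserving.ae_eq_comp (omega_ae e ξ),
    omega_ae e (V ξ), gaussField_comp_gaussMap e V ξ] with z h1 h2 h3 h4
  rw [h1, h3, h2, Function.comp_apply, omegaFun, omegaFun, h4]

theorem omegaFun_add (e : HilbertBasis ι ℝ H) (ξ η : H) :
    omegaFun e (ξ + η) =ᵐ[gaussMeasure ι] fun z => omegaFun e ξ z * omegaFun e η z := by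
  filter_upwards [Lp.coeFn_add (gaussField e ξ) (gaussField e η)] with z hz
  simp only [omegaFun, map_add]
  rw [hz, ← exp_add, Pi.add_apply]
  push_cast
  ring_nf

theorem omegaFun_neg (e : HilbertBasis ι ℝ H) (ξ : H) :
    omegaFun e (-ξ) =ᵐ[gaussMeasure ι] fun z => star (omegaFun e ξ z) := by
  filter_upwards [Lp.coeFn_neg (gaussField e ξ)] with z hz
  simp only [omegaFun, map_neg]
  rw [hz, Pi.neg_apply, star_def, ← exp_conj]
  simp

end Gaussian

section Operators

variable {Y : Type*} [MeasurableSpace Y] {m : Measure Y}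

/-- The operator on `L²` of multiplication by an `L^∞` function. -/
noncomputable def mulOp (φ : Lp ℂ ∞ m) : Lp ℂ 2 m →L[ℂ] Lp ℂ 2 m :=
  (ContinuousLinearMap.mul ℂ ℂ).holderL m ∞ 2 2 φ

theorem mulOp_ae (φ : Lp ℂ ∞ m) (f : Lp ℂ 2 m) : mulOp φ f =ᵐ[m] fun y => φ y * f y :=
  (ContinuousLinearMap.mul ℂ ℂ).coeFn_holder (r := 2) φ f

theorem norm_mulOp_le (φ : Lp ℂ ∞ m) : ‖mulOp φ‖ ≤ ‖φ‖ := by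
  refine ContinuousLinearMap.opNorm_le_bound _ (norm_nonneg _) fun f => ?_
  refine ((ContinuousLinearMap.mul ℂ ℂ).norm_holder_apply_apply_le (r := 2) φ f).trans ?_
  simp

theorem mulOp_comm (φ ψ : Lp ℂ ∞ m) : mulOp φ * mulOp ψ = mulOp ψ * mulOp φ := by
  ext1 f
  apply Lp.ext
  change mulOp φ (mulOp ψ f) =ᵐ[m] mulOp ψ (mulOp φ f)
  filter_upwards [mulOp_ae φ (mulOp ψ f), mulOp_ae ψ f, mulOp_ae ψ (mulOp φ f), mulOp_ae φ f]
    with y h1 h2 h3 h4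
  rw [h1, h2, h3, h4]; ring

theorem star_mulOp (φ : Lp ℂ ∞ m) : star (mulOp φ) = mulOp (star φ) := by
  rw [ContinuousLinearMap.star_eq_adjoint, eq_comm, ContinuousLinearMap.eq_adjoint_iff]
  intro f g
  rw [L2.inner_def, L2.inner_def]
  refine integral_congr_ae ?_
  filter_upwards [mulOp_ae (star φ) f, mulOp_ae φ g, Lp.coeFn_star φ] with y h1 h2 h3
  rw [h1, h2, h3]
  simp
  ring

variable {Γ : Type*} [Group Γ]

/-- The unitary representation `U_g f = f ∘ S_g` on `L²(Y, m)` given by measure preserving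
transformations with `S_{gh} = S_h ∘ S_g` almost everywhere. -/
noncomputable def koopman (S : Γ → Y → Y) (hS : ∀ g, MeasurePreserving (S g) m m)
    (h1 : S 1 =ᵐ[m] id) (hmul : ∀ g h, S (g * h) =ᵐ[m] S h ∘ S g) :
    Γ →* (Lp ℂ 2 m ≃ₗᵢ[ℂ] Lp ℂ 2 m) :=
  have key1 : ∀ f : Lp ℂ 2 m, Lp.compMeasurePreserving (S 1) (hS 1) f = f := fun f => by
    apply Lp.ext
    filter_upwards [Lp.coeFn_compMeasurePreserving f (hS 1), h1] with y hy hy1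
    rw [hy, Function.comp_apply, hy1, id]
  have key : ∀ g h (f : Lp ℂ 2 m), Lp.compMeasurePreserving (S (g * h)) (hS (g * h)) f
      = Lp.compMeasurePreserving (S g) (hS g) (Lp.compMeasurePreserving (S h) (hS h) f) :=
    fun g h f => by
      apply Lp.ext
      filter_upwards [Lp.coeFn_compMeasurePreserving f (hS (g * h)), hmul g h,
        Lp.coeFn_compMeasurePreserving (Lp.compMeasurePreserving (S h) (hS h) f) (hS g),
        (hS g).quasiMeasurePreserving.ae_eq_comp (Lp.coeFn_compMeasurePreserving f (hS h))]
        with y hy1 hy2 hy3 hy4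
      rw [hy1, hy3, hy4, Function.comp_apply, hy2]; rfl
  { toFun := fun g =>
      { (Lp.compMeasurePreservingₗᵢ ℂ (S g) (hS g) : Lp ℂ 2 m →ₗᵢ[ℂ] Lp ℂ 2 m) with
        invFun := fun f => Lp.compMeasurePreserving (S g⁻¹) (hS g⁻¹) f
        left_inv := fun f => by
          refine (key g⁻¹ g f).symm.trans ?_
          simp only [inv_mul_cancel, key1]
        right_inv := fun f => by
          refine (key g g⁻¹ f).symm.trans ?_
          simp only [mul_inv_cancel, key1] }
    map_one' := LinearIsometryEquiv.ext fun f => key1 f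
    map_mul' := fun g h => LinearIsometryEquiv.ext fun f => key g h f }

theorem conj_koopman_mulOp (S : Γ → Y → Y) (hS : ∀ g, MeasurePreserving (S g) m m)
    (h1 : S 1 =ᵐ[m] id) (hmul : ∀ g h, S (g * h) =ᵐ[m] S h ∘ S g) (g : Γ) (φ : Lp ℂ ∞ m) :
    (koopman S hS h1 hmul g).conjStarAlgEquiv (mulOp φ) =
      mulOp (Lp.compMeasurePreserving (S g) (hS g) φ) := by
  have key : ∀ f, koopman S hS h1 hmul g (mulOp φ f) =
      mulOp (Lp.compMeasurePreserving (S g) (hS g) φ) (koopman S hS h1 hmul g f) :=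
    fun f => by
      apply Lp.ext
      change Lp.compMeasurePreserving (S g) (hS g) (mulOp φ f) =ᵐ[_] mulOp _
        (Lp.compMeasurePreserving (S g) (hS g) f)
      filter_upwards [Lp.coeFn_compMeasurePreserving (mulOp φ f) (hS g),
        (hS g).quasiMeasurePreserving.ae_eq_comp (mulOp_ae φ f),
        mulOp_ae (Lp.compMeasurePreserving (S g) (hS g) φ)
          (Lp.compMeasurePreserving (S g) (hS g) f),
        Lp.coeFn_compMeasurePreserving φ (hS g), Lp.coeFn_compMeasurePreserving f (hS g)]
        with p h1 h2 h3 h4 h5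
      rw [h1, h2, h3, h4, h5]; rfl
  ext1 f
  rw [LinearIsometryEquiv.conjStarAlgEquiv_apply_apply, key, LinearIsometryEquiv.apply_symm_apply]

end Operators


section Crossed

variable {K : Type*} [NormedAddCommGroup K] [InnerProductSpace ℂ K] [CompleteSpace K]

/-- The von Neumann algebra generated by a set of bounded operators: the double commutant of
the set and its adjoints. -/
noncomputable def generatedVN (S : Set (K →L[ℂ] K)) : VonNeumannAlgebra K where
  toStarSubalgebra := StarSubalgebra.centralizer ℂ (StarSubalgebra.centralizer ℂ S : Set (K →L[ℂ] K))
  centralizer_centralizer' := by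
    change Set.centralizer (Set.centralizer
      (StarSubalgebra.centralizer ℂ (StarSubalgebra.centralizer ℂ S : Set (K →L[ℂ] K)) :
        Set (K →L[ℂ] K))) = _
    rw [StarSubalgebra.coe_centralizer_centralizer, Set.centralizer_centralizer_centralizer]
    exact (StarSubalgebra.coe_centralizer_centralizer ℂ S).symm

theorem mem_generatedVN {S : Set (K →L[ℂ] K)} {x : K →L[ℂ] K} :
    x ∈ generatedVN S ↔ ∀ y, (∀ s ∈ S, s * y = y * s ∧ star s * y = y * star s) →
      y * x = x * y := by
  change x ∈ StarSubalgebra.centralizer ℂ (StarSubalgebra.centralizer ℂ S : Set (K →L[ℂ] K)) ↔ _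
  rw [StarSubalgebra.mem_centralizer_iff]
  constructor
  · intro h y hy
    exact (h y (by rwa [SetLike.mem_coe, StarSubalgebra.mem_centralizer_iff])).1
  · intro h y hy
    have hy' : star y ∈ StarSubalgebra.centralizer ℂ S := star_mem hy
    rw [SetLike.mem_coe, StarSubalgebra.mem_centralizer_iff] at hy
    rw [StarSubalgebra.mem_centralizer_iff] at hy'
    exact ⟨h y hy, h _ hy'⟩

theorem subset_generatedVN (S : Set (K →L[ℂ] K)) : S ⊆ generatedVN S := fun _ hx =>
  mem_generatedVN.2 fun _ hy => ((hy _ hx).1).symm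

theorem generatedVN_le {S : Set (K →L[ℂ] K)} {N : VonNeumannAlgebra K} (h : S ⊆ N) :
    generatedVN S ≤ N := by
  intro x hx
  rw [mem_generatedVN] at hx
  rw [← N.commutant_commutant, VonNeumannAlgebra.mem_commutant_iff]
  intro y hy
  rw [VonNeumannAlgebra.mem_commutant_iff] at hy
  exact hx y fun s hs => ⟨hy s (h hs), hy _ (star_mem (h hs))⟩

variable {Γ : Type*}

/-- The bounded operator on `ℓ²(Γ, K)` given by a bounded family of operators on `K`. -/
noncomputable def diagOp (T : Γ → K →L[ℂ] K) (C : ℝ≥0) (hT : ∀ g, ‖T g‖ ≤ C) :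
    lp (fun _ : Γ => K) 2 →L[ℂ] lp (fun _ : Γ => K) 2 :=
  have hle : ∀ (f : lp (fun _ : Γ => K) 2) g, ‖T g (f g)‖ ^ (2 : ℝ≥0∞).toReal
      ≤ (C : ℝ) ^ 2 * ‖f g‖ ^ (2 : ℝ≥0∞).toReal := fun f g => by
    have := (T g).le_of_opNorm_le (hT g) (f g)
    simp only [ENNReal.toReal_ofNat, Real.rpow_ofNat]
    rw [← mul_pow]
    gcongr
  LinearMap.mkContinuous
    { toFun := fun f => ⟨fun g => T g (f g), memℓp_gen (Summable.of_nonneg_of_le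
        (fun _ => by positivity) (hle f)
        (((lp.memℓp f).summable (by norm_num)).mul_left _))⟩
      map_add' := fun f f' => by ext g; simp; rfl
      map_smul' := fun c f => by ext g; simp }
    C fun f => by
      refine lp.norm_le_of_tsum_le (by norm_num) (by positivity) ?_
      refine (Summable.tsum_le_tsum (hle f) (Summable.of_nonneg_of_le
        (fun _ => by positivity) (hle f)
        (((lp.memℓp f).summable (by norm_num)).mul_left _))
        (((lp.memℓp f).summable (by norm_num)).mul_left _)).trans ?_
      rw [tsum_mul_left, ← lp.norm_rpow_eq_tsum (by norm_num)]
      simp [mul_pow]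

@[simp] theorem diagOp_apply (T : Γ → K →L[ℂ] K) (C : ℝ≥0) (hT : ∀ g, ‖T g‖ ≤ C)
    (f : lp (fun _ : Γ => K) 2) (g : Γ) : diagOp T C hT f g = T g (f g) := rfl

theorem star_diagOp (T : Γ → K →L[ℂ] K) (C : ℝ≥0) (hT : ∀ g, ‖T g‖ ≤ C) :
    star (diagOp T C hT) = diagOp (fun g => star (T g)) C (fun g => by rw [norm_star]; exact hT g) := by
  rw [ContinuousLinearMap.star_eq_adjoint, eq_comm, ContinuousLinearMap.eq_adjoint_iff]
  intro f f'
  rw [lp.inner_eq_tsum, lp.inner_eq_tsum]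
  refine tsum_congr fun g => ?_
  rw [diagOp_apply, diagOp_apply, ContinuousLinearMap.star_eq_adjoint,
    ContinuousLinearMap.adjoint_inner_left]

theorem diagOp_comm {T T' : Γ → K →L[ℂ] K} {C C' : ℝ≥0} (hT : ∀ g, ‖T g‖ ≤ C)
    (hT' : ∀ g, ‖T' g‖ ≤ C') (h : ∀ g, T g * T' g = T' g * T g) :
    diagOp T C hT * diagOp T' C' hT' = diagOp T' C' hT' * diagOp T C hT := by
  ext1 f
  ext1
  funext g
  exact congrArg (fun A : K →L[ℂ] K => A (f g)) (h g)

theorem conj_mem_generatedVN {S : Set (K →L[ℂ] K)} {w x : K →L[ℂ] K} (hw : star w * w = 1)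
    (hw' : w * star w = 1) (hS : ∀ s ∈ S, w * s * star w ∈ generatedVN S)
    (hx : x ∈ generatedVN S) : w * x * star w ∈ generatedVN S := by
  refine mem_generatedVN.2 fun y hy => ?_
  have hcomm : ∀ z ∈ generatedVN S, y * z = z * y := fun z hz => mem_generatedVN.1 hz y hy
  have hflip : ∀ s, w * s * star w ∈ generatedVN S →
      s * (star w * y * w) = (star w * y * w) * s := fun s hs => by
    have h := congrArg (fun a => star w * a * w) (hcomm _ hs)
    have e1 : star w * (y * (w * s * star w)) * w = (star w * y * w) * s * (star w * w) := by
      simp only [mul_assoc]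
    have e2 : star w * ((w * s * star w) * y) * w = (star w * w) * (s * (star w * y * w)) := by
      simp only [mul_assoc]
    simp only [e1, e2, hw, one_mul, mul_one] at h
    exact h.symm
  have h := mem_generatedVN.1 hx (star w * y * w) fun s hs => by
    refine ⟨hflip s (hS s hs), hflip (star s) ?_⟩
    have := star_mem (hS s hs)
    simpa [mul_assoc] using this
  have h2 := congrArg (fun a => w * a * star w) h
  have e1 : w * ((star w * y * w) * x) * star w = (w * star w) * (y * (w * x * star w)) := by
    simp only [mul_assoc]
  have e2 : w * (x * (star w * y * w)) * star w = ((w * x * star w) * y) * (w * star w) := by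
    simp only [mul_assoc]
  simp only [e1, e2, hw', one_mul, mul_one] at h2
  exact h2

/-- The automorphism `x ↦ w x w*` of a von Neumann algebra normalized by the unitary `w`. -/
noncomputable def restrictConj (N : VonNeumannAlgebra K) (w : K →L[ℂ] K) (hw : star w * w = 1)
    (hw' : w * star w = 1) (h : ∀ x ∈ N, w * x * star w ∈ N) (h' : ∀ x ∈ N, star w * x * w ∈ N) :
    N.toStarSubalgebra ≃⋆ₐ[ℂ] N.toStarSubalgebra where
  toFun x := ⟨w * x * star w, h x x.2⟩
  invFun x := ⟨star w * x * w, h' x x.2⟩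
  left_inv x := Subtype.ext <| by
    change star w * (w * x * star w) * w = x
    rw [mul_assoc w, ← mul_assoc, hw, one_mul, mul_assoc, hw, mul_one]
  right_inv x := Subtype.ext <| by
    change w * (star w * x * w) * star w = x
    rw [mul_assoc (star w), ← mul_assoc, hw', one_mul, mul_assoc, hw', mul_one]
  map_mul' x y := Subtype.ext <| by
    change w * (x * y) * star w = (w * x * star w) * (w * y * star w)
    simp only [mul_assoc]
    rw [← mul_assoc (star w) w, hw, one_mul]
  map_add' x y := Subtype.ext <| by
    change w * (x + y) * star w = w * x * star w + w * y * star w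
    rw [mul_add, add_mul]
  map_smul' c x := Subtype.ext <| by
    change w * (c • (x : K →L[ℂ] K)) * star w = c • (w * x * star w)
    rw [mul_smul_comm, smul_mul_assoc]
  map_star' x := Subtype.ext <| by
    change w * star (x : K →L[ℂ] K) * star w = star (w * x * star w)
    rw [star_mul, star_mul, star_star, mul_assoc]

theorem conjStarAlgEquiv_mem_generatedVN {S : Set (K →L[ℂ] K)} {u : K ≃ₗᵢ[ℂ] K}
    {x : K →L[ℂ] K} (hS : ∀ s ∈ S, u.conjStarAlgEquiv s ∈ generatedVN S)
    (hx : x ∈ generatedVN S) : u.conjStarAlgEquiv x ∈ generatedVN S := by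
  let w : K →L[ℂ] K := u.toContinuousLinearEquiv
  have hw : star w = (u.symm.toContinuousLinearEquiv : K →L[ℂ] K) := u.adjoint_eq_symm
  have h : ∀ y, u.conjStarAlgEquiv y = w * y * star w := fun y => by rw [hw]; rfl
  rw [h]
  refine conj_mem_generatedVN ?_ ?_ (fun s hs => h s ▸ hS s hs) hx
  · rw [hw]; ext1 f; exact u.symm_apply_apply f
  · rw [hw]; ext1 f; exact u.apply_symm_apply f

variable [Group Γ]

/-- The unitary `u_h` on `ℓ²(Γ, K)`: `(u_h f)(g) = f(h⁻¹ g)`. -/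
noncomputable def translation (h : Γ) :
    lp (fun _ : Γ => K) 2 →L[ℂ] lp (fun _ : Γ => K) 2 :=
  LinearMap.mkContinuous
    { toFun := fun f => ⟨fun g => f (h⁻¹ * g), memℓp_gen
        (((Equiv.mulLeft h⁻¹).summable_iff).2 ((lp.memℓp f).summable (by norm_num)))⟩
      map_add' := fun f f' => by ext g; simp; rfl
      map_smul' := fun c f => by ext g; simp }
    1 fun f => by
      refine lp.norm_le_of_tsum_le (by norm_num) (by positivity) ?_
      rw [one_mul, lp.norm_rpow_eq_tsum (by norm_num)]
      exact ((Equiv.mulLeft h⁻¹).tsum_eq fun g => ‖f g‖ ^ (2 : ℝ≥0∞).toReal).le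

@[simp] theorem translation_apply (h : Γ) (f : lp (fun _ : Γ => K) 2) (g : Γ) :
    translation h f g = f (h⁻¹ * g) := rfl

/-- The image of `x` in the crossed product by the action `σ_g = Ad (U g)`: it acts on
`ℓ²(Γ, K)` by `(x f)(g) = σ_{g⁻¹}(x) f(g)`. -/
noncomputable def crossedEmb (U : Γ →* (K ≃ₗᵢ[ℂ] K)) (x : K →L[ℂ] K) :
    lp (fun _ : Γ => K) 2 →L[ℂ] lp (fun _ : Γ => K) 2 :=
  diagOp (fun g => (U g⁻¹).conjStarAlgEquiv x) ‖x‖₊ fun g =>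
    ContinuousLinearMap.opNorm_le_bound _ (by positivity) fun f => by
      simpa using x.le_opNorm ((U g⁻¹).symm f)

/-- The crossed product `N ⋊ Γ ⊆ B(ℓ²(Γ, K))` of a von Neumann algebra `N ⊆ B(K)` by the action
`σ_g = Ad (U g)` of `Γ` on `N`, for a unitary representation `U` that normalizes `N`: it is
generated by the copy of `N` and the unitaries `u_h`. -/
noncomputable def crossedProduct (N : VonNeumannAlgebra K) (U : Γ →* (K ≃ₗᵢ[ℂ] K)) :
    VonNeumannAlgebra (lp (fun _ : Γ => K) 2) :=
  generatedVN (crossedEmb U '' N ∪ Set.range translation)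

theorem crossedEmb_mem {N : VonNeumannAlgebra K} {U : Γ →* (K ≃ₗᵢ[ℂ] K)} {x : K →L[ℂ] K}
    (hx : x ∈ N) : crossedEmb U x ∈ crossedProduct N U :=
  subset_generatedVN _ (Or.inl ⟨x, hx, rfl⟩)

theorem translation_mem {N : VonNeumannAlgebra K} {U : Γ →* (K ≃ₗᵢ[ℂ] K)} (h : Γ) :
    translation h ∈ crossedProduct N U :=
  subset_generatedVN _ (Or.inr ⟨h, rfl⟩)

end Crossed


section Deformation

/-- The Hilbert space `ℓ²(Γ, L²(Z × X))` on which `M̃` acts. -/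
abbrev HilbertK (Γ ι : Type*) {X : Type*} [MeasurableSpace X] (μ : Measure X) : Type _ :=
  lp (fun _ : Γ => Lp ℂ 2 ((gaussMeasure ι).prod μ)) 2

variable {Γ X ι H : Type*} [Group Γ] [MeasurableSpace X] [MulAction Γ X] [MeasurableConstSMul Γ X]
  (μ : Measure X) [IsProbabilityMeasure μ] [SMulInvariantMeasure Γ X μ]
  [Countable ι] [NormedAddCommGroup H] [InnerProductSpace ℝ H]
  (e : HilbertBasis ι ℝ H) (π : Γ →* (H ≃ₗᵢ[ℝ] H))

/-- The transformation of `Z × X` inducing the diagonal action of `g`. -/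
noncomputable def diagonalMap (g : Γ) (p : (ι → ℝ) × X) : (ι → ℝ) × X :=
  (gaussMap e (π g) p.1, g⁻¹ • p.2)

theorem measurePreserving_diagonalMap (g : Γ) :
    MeasurePreserving (diagonalMap e π g) ((gaussMeasure ι).prod μ) ((gaussMeasure ι).prod μ) :=
  (measurePreserving_gaussMap e (π g)).prod (measurePreserving_smul g⁻¹ μ)

/-- The Koopman representation of `Γ` on `L²(Z × X)`; conjugation by it is the diagonal action `σ`
of `Γ` on `D ⊗ A`, the Gaussian action on `D` and `(g a)(x) = a(g⁻¹ x)` on `A`.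
See `conj_omegaOp`, `conj_liftX` and `conj_mem_tensorAlgebra`. -/
noncomputable def diagonalRep :
    Γ →* (Lp ℂ 2 ((gaussMeasure ι).prod μ) ≃ₗᵢ[ℂ] Lp ℂ 2 ((gaussMeasure ι).prod μ)) :=
  koopman (diagonalMap e π) (measurePreserving_diagonalMap μ e π)
    (by
      filter_upwards [Measure.quasiMeasurePreserving_fst.ae (gaussMap_one e)] with p hp
      simp [diagonalMap, hp])
    (fun g h => by
      filter_upwards [Measure.quasiMeasurePreserving_fst.ae (gaussMap_mul e (π g) (π h))] with p hp
      simp [diagonalMap, hp, mul_smul])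

/-- The function `φ ⊗ 1`. -/
noncomputable def liftZ (φ : Lp ℂ ∞ (gaussMeasure ι)) : Lp ℂ ∞ ((gaussMeasure ι).prod μ) :=
  Lp.compMeasurePreserving Prod.fst measurePreserving_fst φ

variable (ι) in
/-- The function `1 ⊗ a`. -/
noncomputable def liftX (a : Lp ℂ ∞ μ) : Lp ℂ ∞ ((gaussMeasure ι).prod μ) :=
  Lp.compMeasurePreserving Prod.snd measurePreserving_snd a

/-- The algebra `D ⊆ L^∞(Z)`: the von Neumann algebra generated by the `ω(ξ)`, `ξ ∈ H`, where
`L^∞(Z)` acts on `L²(Z)` by multiplication. -/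
def gaussAlgebra : Set (Lp ℂ ∞ (gaussMeasure ι)) :=
  {φ | mulOp φ ∈ generatedVN (Set.range fun ξ => mulOp (omega e ξ))}

/-- The von Neumann algebra `D ⊗ A` on `L²(Z × X)`, where `A = L^∞(X)`. -/
noncomputable def tensorAlgebra : VonNeumannAlgebra (Lp ℂ 2 ((gaussMeasure ι).prod μ)) :=
  generatedVN ((fun φ => mulOp (liftZ μ φ)) '' gaussAlgebra e ∪
    Set.range fun a => mulOp (liftX ι μ a))

variable (ι) in
/-- The von Neumann algebra `1 ⊗ A` on `L²(Z × X)`, where `A = L^∞(X)`. -/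
noncomputable def oneTensorAlgebra : VonNeumannAlgebra (Lp ℂ 2 ((gaussMeasure ι).prod μ)) :=
  generatedVN (Set.range fun a => mulOp (liftX ι μ a))

/-- The algebra `M̃ = (D ⊗ A) ⋊ Γ`. -/
noncomputable def Mtilde :
    VonNeumannAlgebra (HilbertK Γ ι μ) :=
  crossedProduct (tensorAlgebra μ e) (diagonalRep μ e π)

/-- The algebra `M = A ⋊ Γ`, as the subalgebra `(1 ⊗ A) ⋊ Γ` of `M̃`. -/
noncomputable def Msub :
    VonNeumannAlgebra (HilbertK Γ ι μ) :=
  crossedProduct (oneTensorAlgebra ι μ) (diagonalRep μ e π)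

theorem Msub_le_Mtilde : Msub μ e π ≤ Mtilde μ e π := by
  refine generatedVN_le (Set.Subset.trans ?_ (subset_generatedVN _))
  refine Set.union_subset_union_left _ (Set.image_mono ?_)
  exact generatedVN_le (Set.Subset.trans Set.subset_union_right (subset_generatedVN _))

/-- The operator `ω(ξ) ⊗ 1`. -/
noncomputable def omegaOp (ξ : H) :
    Lp ℂ 2 ((gaussMeasure ι).prod μ) →L[ℂ] Lp ℂ 2 ((gaussMeasure ι).prod μ) :=
  mulOp (liftZ μ (omega e ξ))

theorem liftZ_omega_ae (ξ : H) :
    liftZ μ (omega e ξ) =ᵐ[(gaussMeasure ι).prod μ] fun p => omegaFun e ξ p.1 := by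
  filter_upwards [Lp.coeFn_compMeasurePreserving (omega e ξ)
      (measurePreserving_fst (μ := gaussMeasure ι) (ν := μ)),
    Measure.quasiMeasurePreserving_fst.ae (omega_ae e ξ)] with p h1 h2
  rw [liftZ, h1, Function.comp_apply, h2]

theorem omegaOp_ae (ξ : H) (f : Lp ℂ 2 ((gaussMeasure ι).prod μ)) :
    omegaOp μ e ξ f =ᵐ[(gaussMeasure ι).prod μ] fun p => omegaFun e ξ p.1 * f p := by
  filter_upwards [mulOp_ae (liftZ μ (omega e ξ)) f, liftZ_omega_ae μ e ξ] with p h1 h2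
  rw [omegaOp, h1, h2]

theorem norm_omegaOp_le (ξ : H) : ‖omegaOp μ e ξ‖ ≤ ((1 : ℝ≥0) : ℝ) := by
  refine (norm_mulOp_le _).trans ?_
  rw [liftZ, Lp.norm_compMeasurePreserving]
  exact norm_omega_le e ξ

theorem omegaOp_add (ξ η : H) : omegaOp μ e (ξ + η) = omegaOp μ e ξ * omegaOp μ e η := by
  ext1 f
  apply Lp.ext
  change omegaOp μ e (ξ + η) f =ᵐ[_] omegaOp μ e ξ (omegaOp μ e η f)
  filter_upwards [omegaOp_ae μ e (ξ + η) f, omegaOp_ae μ e ξ (omegaOp μ e η f),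
    omegaOp_ae μ e η f, Measure.quasiMeasurePreserving_fst.ae (omegaFun_add e ξ η)]
    with p h1 h2 h3 h4
  rw [h1, h2, h3, h4]; ring

theorem omegaOp_zero : omegaOp μ e 0 = 1 := by
  ext1 f
  apply Lp.ext
  filter_upwards [omegaOp_ae μ e 0 f,
    Measure.quasiMeasurePreserving_fst.ae (Lp.coeFn_zero ℝ 2 (gaussMeasure ι))] with p h1 h2
  rw [h1]
  simp only [omegaFun, map_zero]
  rw [h2]
  simp

theorem star_omegaOp (ξ : H) : star (omegaOp μ e ξ) = omegaOp μ e (-ξ) := by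
  rw [omegaOp, star_mulOp]
  ext1 f
  apply Lp.ext
  filter_upwards [omegaOp_ae μ e (-ξ) f, mulOp_ae (star (liftZ μ (omega e ξ))) f,
    Lp.coeFn_star (liftZ μ (omega e ξ)), liftZ_omega_ae μ e ξ,
    Measure.quasiMeasurePreserving_fst.ae (omegaFun_neg e ξ)] with p h1 h2 h3 h4 h5
  rw [h1, h2, h3, Pi.star_apply, h4, h5]

theorem conj_mulOp (g : Γ) (φ : Lp ℂ ∞ ((gaussMeasure ι).prod μ)) :
    (diagonalRep μ e π g).conjStarAlgEquiv (mulOp φ) =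
      mulOp (Lp.compMeasurePreserving (diagonalMap e π g)
        (measurePreserving_diagonalMap μ e π g) φ) :=
  conj_koopman_mulOp _ _ _ _ g φ

theorem conj_liftX (g : Γ) (a : Lp ℂ ∞ μ) :
    (diagonalRep μ e π g).conjStarAlgEquiv (mulOp (liftX ι μ a)) =
      mulOp (liftX ι μ (Lp.compMeasurePreserving (g⁻¹ • ·) (measurePreserving_smul g⁻¹ μ) a)) := by
  rw [conj_mulOp]
  congr 1
  rw [liftX, liftX, ← Lp.compMeasurePreserving_comp_apply, ← Lp.compMeasurePreserving_comp_apply]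
  rfl

/-- The Koopman representation of `Γ` on `L²(Z)`; conjugation by it is the Gaussian action. -/
noncomputable def gaussRep : Γ →* (Lp ℂ 2 (gaussMeasure ι) ≃ₗᵢ[ℂ] Lp ℂ 2 (gaussMeasure ι)) :=
  koopman (fun g => gaussMap e (π g)) (fun g => measurePreserving_gaussMap e (π g))
    (by rw [map_one]; exact gaussMap_one e) (fun g h => by rw [map_mul]; exact gaussMap_mul e _ _)

theorem conj_gaussRep_mulOp (g : Γ) (φ : Lp ℂ ∞ (gaussMeasure ι)) :
    (gaussRep e π g).conjStarAlgEquiv (mulOp φ) =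
      mulOp (Lp.compMeasurePreserving (gaussMap e (π g)) (measurePreserving_gaussMap e (π g)) φ) :=
  conj_koopman_mulOp _ _ _ _ g φ

/-- The Gaussian action preserves `D`. -/
theorem gaussAlgebra_comp (g : Γ) {φ : Lp ℂ ∞ (gaussMeasure ι)} (hφ : φ ∈ gaussAlgebra e) :
    Lp.compMeasurePreserving (gaussMap e (π g)) (measurePreserving_gaussMap e (π g)) φ
      ∈ gaussAlgebra e := by
  change mulOp _ ∈ generatedVN _
  rw [← conj_gaussRep_mulOp]
  refine conjStarAlgEquiv_mem_generatedVN ?_ hφ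
  rintro _ ⟨ξ, rfl⟩
  rw [conj_gaussRep_mulOp, omega_comp_gaussMap]
  exact subset_generatedVN _ ⟨_, rfl⟩

/-- The diagonal action preserves `D ⊗ A`. -/
theorem conj_mem_tensorAlgebra (g : Γ)
    {x : Lp ℂ 2 ((gaussMeasure ι).prod μ) →L[ℂ] Lp ℂ 2 ((gaussMeasure ι).prod μ)}
    (hx : x ∈ tensorAlgebra μ e) :
    (diagonalRep μ e π g).conjStarAlgEquiv x ∈ tensorAlgebra μ e := by
  refine conjStarAlgEquiv_mem_generatedVN ?_ hx
  rintro _ (⟨φ, hφ, rfl⟩ | ⟨a, rfl⟩)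
  · refine subset_generatedVN _ (Or.inl ⟨_, gaussAlgebra_comp e π g hφ, ?_⟩)
    change mulOp _ = (diagonalRep μ e π g).conjStarAlgEquiv (mulOp (liftZ μ φ))
    rw [conj_mulOp]
    congr 1
    rw [liftZ, liftZ, ← Lp.compMeasurePreserving_comp_apply,
      ← Lp.compMeasurePreserving_comp_apply]
    rfl
  · change (diagonalRep μ e π g).conjStarAlgEquiv (mulOp (liftX ι μ a)) ∈ _
    rw [conj_liftX]
    exact subset_generatedVN _ (Or.inr ⟨_, rfl⟩)

/-- The diagonal action sends `ω(ξ) ⊗ 1` to `ω(π(g) ξ) ⊗ 1`. -/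
theorem conj_omegaOp (g : Γ) (ξ : H) :
    (diagonalRep μ e π g).conjStarAlgEquiv (omegaOp μ e ξ) = omegaOp μ e (π g ξ) := by
  rw [omegaOp, conj_mulOp, omegaOp]
  congr 1
  apply Lp.ext
  have hS := measurePreserving_diagonalMap μ e π g
  filter_upwards [Lp.coeFn_compMeasurePreserving (liftZ μ (omega e ξ)) hS,
    hS.quasiMeasurePreserving.ae_eq_comp (liftZ_omega_ae μ e ξ), liftZ_omega_ae μ e (π g ξ),
    Measure.quasiMeasurePreserving_fst.ae (gaussField_comp_gaussMap e (π g) ξ)] with p h1 h2 h3 h4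
  rw [h1, h2, h3, Function.comp_apply, omegaFun, omegaFun, ← h4]
  rfl

variable (b : Γ → H)

/-- The unitary on `ℓ²(Γ, L²(Z × X))` that acts on the `g`-th component by
`ω(-t b(g⁻¹)) ⊗ 1`. It implements the deformation `α_t`. -/
noncomputable def deformationUnitary (t : ℝ) :
    HilbertK Γ ι μ →L[ℂ]
      HilbertK Γ ι μ :=
  diagOp (fun g => omegaOp μ e (-(t • b g⁻¹))) 1 fun _ => norm_omegaOp_le μ e _

theorem star_deformationUnitary (t : ℝ) :
    star (deformationUnitary μ e b t) = deformationUnitary μ e b (-t) := by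
  rw [deformationUnitary, star_diagOp]
  ext1 f
  ext1
  funext g
  simp [deformationUnitary, star_omegaOp]

theorem deformationUnitary_mul_neg (t : ℝ) :
    deformationUnitary μ e b t * deformationUnitary μ e b (-t) = 1 := by
  ext1 f
  ext1
  funext g
  change omegaOp μ e (-(t • b g⁻¹)) (omegaOp μ e (-(-t • b g⁻¹)) (f g)) = f g
  rw [← mul_apply_eq_comp, ← omegaOp_add]
  simp [omegaOp_zero]

theorem deformationUnitary_mul_star (t : ℝ) :
    deformationUnitary μ e b t * star (deformationUnitary μ e b t) = 1 := by
  rw [star_deformationUnitary, deformationUnitary_mul_neg]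

theorem star_deformationUnitary_mul (t : ℝ) :
    star (deformationUnitary μ e b t) * deformationUnitary μ e b t = 1 := by
  have := deformationUnitary_mul_neg μ e b (-t)
  rwa [neg_neg, ← star_deformationUnitary] at this

theorem omegaOp_comm (ξ : H)
    {x : Lp ℂ 2 ((gaussMeasure ι).prod μ) →L[ℂ] Lp ℂ 2 ((gaussMeasure ι).prod μ)}
    (hx : x ∈ tensorAlgebra μ e) : omegaOp μ e ξ * x = x * omegaOp μ e ξ := by
  refine mem_generatedVN.1 hx _ ?_
  rintro s (⟨φ, -, rfl⟩ | ⟨a, rfl⟩)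
  · exact ⟨mulOp_comm _ _, by rw [star_mulOp]; exact mulOp_comm _ _⟩
  · exact ⟨mulOp_comm _ _, by rw [star_mulOp]; exact mulOp_comm _ _⟩

theorem deformationUnitary_comm (t : ℝ)
    {x : Lp ℂ 2 ((gaussMeasure ι).prod μ) →L[ℂ] Lp ℂ 2 ((gaussMeasure ι).prod μ)}
    (hx : x ∈ tensorAlgebra μ e) :
    deformationUnitary μ e b t * crossedEmb (diagonalRep μ e π) x =
      crossedEmb (diagonalRep μ e π) x * deformationUnitary μ e b t := by
  refine diagOp_comm _ _ fun g => ?_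
  have h : omegaOp μ e (-(t • b g⁻¹)) = (diagonalRep μ e π g⁻¹).conjStarAlgEquiv
      (omegaOp μ e (π g (-(t • b g⁻¹)))) := by
    rw [conj_omegaOp, map_inv]
    exact congrArg (omegaOp μ e) ((π g).symm_apply_apply _).symm
  rw [h, ← map_mul, ← map_mul, omegaOp_comm μ e _ hx]

/-- `b` is a 1-cocycle for `π`. -/
def IsOneCocycle (π : Γ →* (H ≃ₗᵢ[ℝ] H)) (b : Γ → H) : Prop :=
  ∀ g h, b (g * h) = π g (b h) + b g

variable {b}

theorem omegaOp_mem (ξ : H) : omegaOp μ e ξ ∈ tensorAlgebra μ e :=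
  subset_generatedVN _ (Or.inl ⟨omega e ξ, subset_generatedVN _ ⟨ξ, rfl⟩, rfl⟩)

theorem deformationUnitary_translation (hb : IsOneCocycle π b) (t : ℝ) (h : Γ) :
    deformationUnitary μ e b t * translation h * star (deformationUnitary μ e b t) =
      crossedEmb (diagonalRep μ e π) (omegaOp μ e (t • b h)) * translation h := by
  rw [star_deformationUnitary]
  ext1 f
  ext1
  funext g
  change omegaOp μ e (-(t • b g⁻¹)) (omegaOp μ e (-(-t • b (h⁻¹ * g)⁻¹)) (f (h⁻¹ * g))) =
    (diagonalRep μ e π g⁻¹).conjStarAlgEquiv (omegaOp μ e (t • b h)) (f (h⁻¹ * g))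
  rw [conj_omegaOp, ← mul_apply_eq_comp, ← omegaOp_add, mul_inv_rev, inv_inv, hb, map_smul]
  congr 2
  simp

theorem deformation_mem (hb : IsOneCocycle π b) (t : ℝ)
    {x : HilbertK Γ ι μ →L[ℂ]
      HilbertK Γ ι μ} (hx : x ∈ Mtilde μ e π) :
    deformationUnitary μ e b t * x * star (deformationUnitary μ e b t) ∈ Mtilde μ e π := by
  have h1 := deformationUnitary_mul_star μ e b t
  have h2 := star_deformationUnitary_mul μ e b t
  refine conj_mem_generatedVN h2 h1 ?_ hx
  rintro s (⟨x, hx, rfl⟩ | ⟨h, rfl⟩)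
  · rw [deformationUnitary_comm μ e π b t hx, mul_assoc, h1, mul_one]
    exact subset_generatedVN _ (Or.inl ⟨x, hx, rfl⟩)
  · rw [deformationUnitary_translation μ e π hb]
    exact mul_mem (subset_generatedVN _ (Or.inl ⟨_, omegaOp_mem μ e _, rfl⟩))
      (subset_generatedVN _ (Or.inr ⟨h, rfl⟩))

/-- The automorphism `α_t` of `M̃`. It is normal, being implemented by a unitary, and it is the identity
on `D ⊗ A` and maps `u_h` to `(ω(t b(h)) ⊗ 1) u_h`: see `deformation_crossedEmb` and
`deformation_translation`. These properties determine it, as `D ⊗ A` and the `u_h` generate `M̃`. -/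
noncomputable def deformation (hb : IsOneCocycle π b) (t : ℝ) :
    (Mtilde μ e π).toStarSubalgebra ≃⋆ₐ[ℂ] (Mtilde μ e π).toStarSubalgebra :=
  restrictConj (Mtilde μ e π) (deformationUnitary μ e b t)
    (star_deformationUnitary_mul μ e b t) (deformationUnitary_mul_star μ e b t)
    (fun _ hx => deformation_mem μ e π hb t hx)
    (fun x hx => by
      have h := deformation_mem μ e π hb (-t) hx
      rwa [← star_deformationUnitary, star_star] at h)

theorem deformation_crossedEmb (hb : IsOneCocycle π b) (t : ℝ)
    {x : Lp ℂ 2 ((gaussMeasure ι).prod μ) →L[ℂ] Lp ℂ 2 ((gaussMeasure ι).prod μ)}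
    (hx : x ∈ tensorAlgebra μ e) :
    (deformation μ e π hb t ⟨crossedEmb (diagonalRep μ e π) x, crossedEmb_mem hx⟩ :
      HilbertK Γ ι μ →L[ℂ] HilbertK Γ ι μ) = crossedEmb (diagonalRep μ e π) x := by
  change deformationUnitary μ e b t * _ * star (deformationUnitary μ e b t) = _
  rw [deformationUnitary_comm μ e π b t hx, mul_assoc, deformationUnitary_mul_star, mul_one]

theorem deformation_translation (hb : IsOneCocycle π b) (t : ℝ) (h : Γ) :
    (deformation μ e π hb t ⟨translation h, translation_mem h⟩ : HilbertK Γ ι μ →L[ℂ] HilbertK Γ ι μ) =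
      crossedEmb (diagonalRep μ e π) (omegaOp μ e (t • b h)) * translation h :=
  deformationUnitary_translation μ e π hb t h

variable (Γ ι) in
/-- The vector `1 ⊗ δ_e` of `ℓ²(Γ, L²(Z × X))`. -/
noncomputable def vacuum : HilbertK Γ ι μ := by
  classical exact lp.single 2 1 (Lp.const 2 ((gaussMeasure ι).prod μ) (1 : ℂ))

variable {μ}

/-- The trace of `M̃`: the vector functional of `1 ⊗ δ_e`, so that `τ(x u_h)` is the integral of `x`
when `h = e` and zero otherwise, for `x` in `D ⊗ A`. -/
noncomputable def tau (x : HilbertK Γ ι μ →L[ℂ]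
      HilbertK Γ ι μ) : ℂ :=
  inner ℂ (vacuum Γ ι μ) (x (vacuum Γ ι μ))

/-- The 2-norm `‖x‖₂ = τ(x* x)^{1/2}`. -/
noncomputable def twoNorm (x : HilbertK Γ ι μ →L[ℂ]
      HilbertK Γ ι μ) : ℝ :=
  Real.sqrt (tau (star x * x)).re

/-- `y` is the image of `x` under the `τ`-preserving conditional expectation onto `N`. -/
def IsCondExp (N : VonNeumannAlgebra (HilbertK Γ ι μ))
    (x y : HilbertK Γ ι μ →L[ℂ]
      HilbertK Γ ι μ) : Prop :=
  y ∈ N ∧ ∀ z ∈ N, tau (y * z) = tau (x * z)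

open Classical in
/-- The `τ`-preserving conditional expectation `E_N : M̃ → N` onto a von Neumann subalgebra `N`
of `M̃`: `E_N(x)` is the unique `y ∈ N` with `τ(y z) = τ(x z)` for all `z ∈ N`. For every `x ∈ M̃`
such a `y` exists, as `τ` is a faithful normal trace on `M̃`. -/
noncomputable def condExp
    (N : VonNeumannAlgebra (HilbertK Γ ι μ))
    (x : HilbertK Γ ι μ →L[ℂ]
      HilbertK Γ ι μ) :
    HilbertK Γ ι μ →L[ℂ]
      HilbertK Γ ι μ :=
  if h : ∃ y, IsCondExp N x y then h.choose else 0

end Deformation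

end CocycleDeformation

/-!
Let `v = 1 ⊗ δ_e` be the trace vector, let `x ∈ M`, and let `W_t` be the unitary that implements
`α_t`; it fixes `v`, as `b(e) = 0`. For `z ∈ M` this gives `τ(α_t(x) z) = ⟨W_t x* v, z v⟩`. Here
`x* v` and `z v` lie in `ℓ²(Γ, 1 ⊗ L²(X))`, to which `ω(ξ) ⊗ 1` compresses as the scalar
`∫ ω(ξ) dν = exp(-‖ξ‖²)`. Hence `τ(α_t(x) z) = ⟨R x* v, R z v⟩`, where the contraction `R`
multiplies the `g`-th component by `exp(-‖t b(g⁻¹)‖² / 2)`.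

With `z = x*` this is `τ(α_t(x) x*) = ‖R x* v‖²`. With `y = E_M(α_t(x))` and `z = y*` it is
`‖y* v‖² = ⟨R x* v, R y* v⟩ ≤ ‖R x* v‖ ‖y* v‖`, and `‖y* v‖ = ‖y v‖ = ‖y‖₂` because `τ` is a trace
on `M`.
-/

namespace CocycleDeformation

open MeasureTheory Complex
open scoped ENNReal NNReal

section Commutant

variable {K : Type*} [NormedAddCommGroup K] [InnerProductSpace ℂ K] [CompleteSpace K]

theorem mem_commutant_generatedVN {S : Set (K →L[ℂ] K)} (hS : ∀ s ∈ S, star s ∈ S)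
    {y : K →L[ℂ] K} : y ∈ (generatedVN S).commutant ↔ ∀ s ∈ S, s * y = y * s := by
  rw [VonNeumannAlgebra.mem_commutant_iff]
  exact ⟨fun h s hs => h s (subset_generatedVN S hs), fun h x hx =>
    (mem_generatedVN.1 hx y fun s hs => ⟨h s hs, h _ (hS s hs)⟩).symm⟩

theorem starProjection_mem_commutant_generatedVN {S : Set (K →L[ℂ] K)}
    (hS : ∀ s ∈ S, star s ∈ S) (V : Submodule ℂ K) [V.HasOrthogonalProjection]
    (hV : ∀ s ∈ S, ∀ f ∈ V, s f ∈ V) : V.starProjection ∈ (generatedVN S).commutant := by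
  set P := V.starProjection
  have hP : star P = P := isStarProjection_starProjection.isSelfAdjoint.star_eq
  have hPs : ∀ s ∈ S, P * s * P = s * P := fun s hs => by
    ext1 f
    exact Submodule.starProjection_eq_self_iff.2 (hV s hs _ (V.starProjection_apply_mem f))
  refine (mem_commutant_generatedVN hS).2 fun s hs => ?_
  calc s * P = P * s * P := (hPs s hs).symm
    _ = star (P * star s * P) := by simp only [star_mul, star_star, hP, mul_assoc]
    _ = star (star s * P) := by rw [hPs _ (hS s hs)]
    _ = P * s := by rw [star_mul, star_star, hP]

end Commutant

section CrossedProduct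

variable {Γ K : Type*} [NormedAddCommGroup K] [InnerProductSpace ℂ K]

theorem norm_diagOp_le (T : Γ → K →L[ℂ] K) (C : ℝ≥0) (hT : ∀ g, ‖T g‖ ≤ C) :
    ‖diagOp T C hT‖ ≤ C := by
  unfold diagOp
  exact LinearMap.mkContinuous_norm_le _ C.coe_nonneg _

section RightTranslation

variable [Group Γ]

/-- The unitary `(ρ_h f)(g) = U_h f(g h)` on `ℓ²(Γ, K)`. The twist by `U_h` makes it commute with
the copy of `B(K)` in the crossed product by `Ad U`. -/
noncomputable def rightTranslation (U : Γ →* (K ≃ₗᵢ[ℂ] K)) (h : Γ) :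
    lp (fun _ : Γ => K) 2 →L[ℂ] lp (fun _ : Γ => K) 2 :=
  LinearMap.mkContinuous
    { toFun := fun f => ⟨fun g => U h (f (g * h)), memℓp_gen (by
        simp only [LinearIsometryEquiv.norm_map]
        exact ((Equiv.mulRight h).summable_iff (f := fun g => ‖f g‖ ^ (2 : ℝ≥0∞).toReal)).2
          ((lp.memℓp f).summable (by norm_num)))⟩
      map_add' := fun f f' => by ext g; simp; rfl
      map_smul' := fun c f => by ext g; simp }
    1 fun f => by
      refine lp.norm_le_of_tsum_le (by norm_num) (by positivity) ?_
      rw [one_mul, lp.norm_rpow_eq_tsum (by norm_num)]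
      rw [← (Equiv.mulRight h).tsum_eq fun g => ‖f g‖ ^ (2 : ℝ≥0∞).toReal]
      exact (tsum_congr fun g => congrArg (· ^ (2 : ℝ≥0∞).toReal) ((U h).norm_map _)).le

@[simp] theorem rightTranslation_apply (U : Γ →* (K ≃ₗᵢ[ℂ] K)) (h : Γ)
    (f : lp (fun _ : Γ => K) 2) (g : Γ) : rightTranslation U h f g = U h (f (g * h)) := rfl

theorem rightTranslation_single [DecidableEq Γ] (U : Γ →* (K ≃ₗᵢ[ℂ] K)) (g h : Γ) (ξ : K) :
    rightTranslation U h (lp.single 2 g ξ) = lp.single 2 (g * h⁻¹) (U h ξ) := by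
  ext1
  funext k
  rw [rightTranslation_apply]
  by_cases hk : k = g * h⁻¹
  · rw [hk, inv_mul_cancel_right, lp.single_apply_self, lp.single_apply_self]
  · rw [lp.single_apply_ne _ _ _ hk, lp.single_apply_ne _ _ _ (mt eq_mul_inv_of_mul_eq hk),
      map_zero]

end RightTranslation

variable [CompleteSpace K]

theorem diagOp_single [DecidableEq Γ] (T : Γ → K →L[ℂ] K) (C : ℝ≥0) (hT : ∀ g, ‖T g‖ ≤ C)
    (g : Γ) (ξ : K) : diagOp T C hT (lp.single 2 g ξ) = lp.single 2 g (T g ξ) := by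
  ext1
  funext k
  rw [diagOp_apply, lp.single_apply, lp.single_apply]
  exact Pi.apply_single (fun g => T g) (fun g => map_zero (T g)) g ξ k

/-- The operator `1 ⊗ T` on `ℓ²(Γ, K)`, which applies `T` in every component. -/
noncomputable def constOp (Γ : Type*) (T : K →L[ℂ] K) :
    lp (fun _ : Γ => K) 2 →L[ℂ] lp (fun _ : Γ => K) 2 :=
  diagOp (fun _ => T) ‖T‖₊ fun _ => (coe_nnnorm T).ge

theorem constOp_single [DecidableEq Γ] (T : K →L[ℂ] K) (g : Γ) (ξ : K) :
    constOp Γ T (lp.single 2 g ξ) = lp.single 2 g (T ξ) :=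
  diagOp_single _ _ _ g ξ

variable [Group Γ]

theorem crossedEmb_mul_rightTranslation (U : Γ →* (K ≃ₗᵢ[ℂ] K)) (x : K →L[ℂ] K) (h : Γ) :
    crossedEmb U x * rightTranslation U h = rightTranslation U h * crossedEmb U x := by
  have hconj : ∀ (g : Γ) (f : K), (U g⁻¹).conjStarAlgEquiv x f = U g⁻¹ (x (U g f)) := fun g f => by
    rw [LinearIsometryEquiv.conjStarAlgEquiv_apply_apply]
    rw [map_inv]
    rfl
  ext1 f
  ext1
  funext g
  change (U g⁻¹).conjStarAlgEquiv x (U h (f (g * h))) =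
    U h ((U (g * h)⁻¹).conjStarAlgEquiv x (f (g * h)))
  have hmul : ∀ (g k : Γ) (f : K), U (g * k) f = U g (U k f) := fun g k f => by rw [map_mul]; rfl
  rw [hconj, hconj, ← hmul, ← hmul, mul_inv_rev, mul_inv_cancel_left]

theorem star_translation (h : Γ) :
    star (translation h : lp (fun _ : Γ => K) 2 →L[ℂ] lp (fun _ : Γ => K) 2) =
      translation h⁻¹ := by
  rw [ContinuousLinearMap.star_eq_adjoint, eq_comm, ContinuousLinearMap.eq_adjoint_iff]
  intro f f'
  rw [lp.inner_eq_tsum, lp.inner_eq_tsum, ← (Equiv.mulLeft h⁻¹).tsum_eq]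
  simp only [translation_apply, Equiv.coe_mulLeft, inv_inv, mul_inv_cancel_left]

theorem star_crossedEmb (U : Γ →* (K ≃ₗᵢ[ℂ] K)) (x : K →L[ℂ] K) :
    star (crossedEmb U x) = crossedEmb U (star x) := by
  rw [crossedEmb, star_diagOp]
  ext1 f
  ext1
  funext g
  simp only [crossedEmb, diagOp_apply, map_star]

variable {N : VonNeumannAlgebra K} {U : Γ →* (K ≃ₗᵢ[ℂ] K)}

theorem mem_commutant_crossedProduct {y : lp (fun _ : Γ => K) 2 →L[ℂ] lp (fun _ : Γ => K) 2} :
    y ∈ (crossedProduct N U).commutant ↔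
      (∀ x ∈ N, crossedEmb U x * y = y * crossedEmb U x) ∧
        ∀ h, translation h * y = y * translation h := by
  have hstar : ∀ s ∈ crossedEmb U '' N ∪ Set.range translation,
      star s ∈ crossedEmb U '' N ∪ Set.range translation := by
    rintro _ (⟨x, hx, rfl⟩ | ⟨h, rfl⟩)
    · exact Or.inl ⟨star x, star_mem hx, (star_crossedEmb U x).symm⟩
    · exact Or.inr ⟨h⁻¹, (star_translation h).symm⟩
  rw [crossedProduct, mem_commutant_generatedVN hstar]
  simp only [Set.mem_union, or_imp, forall_and, Set.forall_mem_image, Set.forall_mem_range,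
    SetLike.mem_coe]

theorem rightTranslation_mem_commutant (h : Γ) :
    rightTranslation U h ∈ (crossedProduct N U).commutant := by
  refine mem_commutant_crossedProduct.2
    ⟨fun x _ => crossedEmb_mul_rightTranslation U x h, fun k => ?_⟩
  ext f g
  simp only [ContinuousLinearMap.mul_def, ContinuousLinearMap.comp_apply, translation_apply,
    rightTranslation_apply, mul_assoc]

theorem constOp_mem_commutant (hU : ∀ g, ∀ x ∈ N, (U g).conjStarAlgEquiv x ∈ N) {T : K →L[ℂ] K}
    (hT : T ∈ N.commutant) : constOp Γ T ∈ (crossedProduct N U).commutant := by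
  rw [VonNeumannAlgebra.mem_commutant_iff] at hT
  refine mem_commutant_crossedProduct.2 ⟨fun x hx => ?_, fun h => ?_⟩
  · rw [crossedEmb, constOp, diagOp_comm _ _ fun g => hT _ (hU g⁻¹ x hx)]
  · ext f g
    rfl

variable [DecidableEq Γ] {x : lp (fun _ : Γ => K) 2 →L[ℂ] lp (fun _ : Γ => K) 2} {T : K →L[ℂ] K}
  {ξ : K}

theorem apply_single_of_fixed (hU : ∀ g, ∀ x ∈ N, (U g).conjStarAlgEquiv x ∈ N)
    (hx : x ∈ crossedProduct N U) (hT : T ∈ N.commutant) (hTξ : T ξ = ξ) (g k : Γ) :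
    T (x (lp.single 2 k ξ) g) = x (lp.single 2 k ξ) g := by
  have hcomm := VonNeumannAlgebra.mem_commutant_iff.1 (constOp_mem_commutant hU hT) x hx
  have hfix : constOp Γ T (lp.single 2 k ξ) = lp.single 2 k ξ := by
    rw [constOp_single, hTξ]
  calc T (x (lp.single 2 k ξ) g) = (constOp Γ T * x) (lp.single 2 k ξ) g := rfl
    _ = x (constOp Γ T (lp.single 2 k ξ)) g := by rw [← hcomm]; rfl
    _ = x (lp.single 2 k ξ) g := by rw [hfix]

theorem inner_star_apply_single (hU : ∀ g, ∀ x ∈ N, (U g).conjStarAlgEquiv x ∈ N)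
    (hx : x ∈ crossedProduct N U) (hT : T ∈ N.commutant) (hUξ : ∀ g, U g ξ = ξ) (g : Γ) :
    inner ℂ (star x (lp.single 2 1 ξ) g) (T ξ) =
      inner ℂ ξ (T (U g⁻¹ (x (lp.single 2 1 ξ) g⁻¹))) := by
  set v : lp (fun _ : Γ => K) 2 := lp.single 2 1 ξ
  let A := constOp Γ T * rightTranslation U g⁻¹
  have hA : A ∈ (crossedProduct N U).commutant :=
    mul_mem (constOp_mem_commutant hU hT) (rightTranslation_mem_commutant g⁻¹)
  have hAv : A v = lp.single 2 g (T ξ) := by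
    change constOp Γ T (rightTranslation U g⁻¹ (lp.single 2 1 ξ)) = _
    rw [rightTranslation_single, one_mul, inv_inv, constOp_single, hUξ]
  calc inner ℂ (star x v g) (T ξ) = inner ℂ (star x v) (A v) := by
        rw [hAv, lp.inner_single_right]
    _ = inner ℂ v ((x * A) v) := by
        rw [ContinuousLinearMap.star_eq_adjoint, ContinuousLinearMap.adjoint_inner_left]; rfl
    _ = inner ℂ v ((A * x) v) := by rw [VonNeumannAlgebra.mem_commutant_iff.1 hA x hx]
    _ = inner ℂ ξ ((A * x) v 1) := lp.inner_single_left _ _ _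
    _ = inner ℂ ξ (T (U g⁻¹ (x v g⁻¹))) := by
        change inner ℂ ξ (T (U g⁻¹ (x v (1 * g⁻¹)))) = _
        rw [one_mul]

end CrossedProduct

section Lp

variable {Y Y' : Type*} [MeasurableSpace Y] [MeasurableSpace Y'] {m : Measure Y} {m' : Measure Y'}

theorem norm_star_Lp {E : Type*} [NormedAddCommGroup E] [StarAddMonoid E] [NormedStarGroup E]
    {p : ℝ≥0∞} (f : Lp E p m) : ‖star f‖ = ‖f‖ :=
  congrArg ENNReal.toReal AEEqFun.eLpNorm_star

theorem star_compMeasurePreserving {E : Type*} [NormedAddCommGroup E] [StarAddMonoid E]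
    [NormedStarGroup E] {p : ℝ≥0∞} {S : Y → Y'} (hS : MeasurePreserving S m m') (f : Lp E p m') :
    star (Lp.compMeasurePreserving S hS f) = Lp.compMeasurePreserving S hS (star f) := by
  apply Lp.ext
  filter_upwards [Lp.coeFn_star (Lp.compMeasurePreserving S hS f),
    Lp.coeFn_compMeasurePreserving f hS, Lp.coeFn_compMeasurePreserving (star f) hS,
    hS.quasiMeasurePreserving.ae_eq_comp (Lp.coeFn_star f)] with y h1 h2 h3 h4
  rw [h1, Pi.star_apply, h2, h3, h4]
  rfl

theorem compMeasurePreserving_const {E : Type*} [NormedAddCommGroup E] {p : ℝ≥0∞}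
    [IsFiniteMeasure m] [IsFiniteMeasure m'] {S : Y → Y'} (hS : MeasurePreserving S m m') (c : E) :
    Lp.compMeasurePreserving S hS (Lp.const p m' c) = Lp.const p m c :=
  Lp.toLp_compMeasurePreserving (memLp_const c) hS

theorem mulOp_compMeasurePreserving {S : Y → Y'} (hS : MeasurePreserving S m m')
    (φ : Lp ℂ ∞ m') (f : Lp ℂ 2 m') :
    mulOp (Lp.compMeasurePreserving S hS φ) (Lp.compMeasurePreserving S hS f) =
      Lp.compMeasurePreserving S hS (mulOp φ f) := by
  apply Lp.ext
  filter_upwards [mulOp_ae (Lp.compMeasurePreserving S hS φ) (Lp.compMeasurePreserving S hS f),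
    Lp.coeFn_compMeasurePreserving φ hS, Lp.coeFn_compMeasurePreserving f hS,
    Lp.coeFn_compMeasurePreserving (mulOp φ f) hS,
    hS.quasiMeasurePreserving.ae_eq_comp (mulOp_ae φ f)] with y h1 h2 h3 h4 h5
  rw [h1, h2, h3, h4, h5]
  rfl

variable [IsFiniteMeasure m]

theorem mulOp_indicator_const {s : Set Y} (hs : MeasurableSet s) :
    mulOp (indicatorConstLp ∞ hs (measure_ne_top m s) (1 : ℂ)) (Lp.const 2 m (1 : ℂ)) =
      indicatorConstLp 2 hs (measure_ne_top m s) (1 : ℂ) := by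
  apply Lp.ext
  filter_upwards [mulOp_ae (indicatorConstLp ∞ hs (measure_ne_top m s) (1 : ℂ)) (Lp.const 2 m 1),
    indicatorConstLp_coeFn (p := ∞) (hs := hs) (hμs := measure_ne_top m s) (c := (1 : ℂ)),
    indicatorConstLp_coeFn (p := 2) (hs := hs) (hμs := measure_ne_top m s) (c := (1 : ℂ)),
    Lp.coeFn_const (p := 2) m (1 : ℂ)] with y h1 h2 h3 h4
  rw [h1, h2, h3, h4, Function.const_apply, mul_one]

theorem ext_inner_mulOp_const {f f' : Lp ℂ 2 m} (h : ∀ φ : Lp ℂ ∞ m,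
    inner ℂ f (mulOp φ (Lp.const 2 m 1)) = inner ℂ f' (mulOp φ (Lp.const 2 m 1))) : f = f' := by
  have hint : ∀ (f : Lp ℂ 2 m) (s : Set Y), IntegrableOn f s m := fun f s =>
    ((Lp.memLp f).integrable one_le_two).integrableOn
  refine Lp.ext (Lp.ae_eq_of_forall_setIntegral_eq f f' two_ne_zero ENNReal.ofNat_ne_top
    (fun s _ _ => hint f s) (fun s _ _ => hint f' s) fun s hs _ => ?_)
  have hφ := h (indicatorConstLp ∞ hs (measure_ne_top m s) 1)
  rw [mulOp_indicator_const hs] at hφ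
  rw [← L2.inner_indicatorConstLp_one hs (measure_ne_top m s),
    ← L2.inner_indicatorConstLp_one hs (measure_ne_top m s), ← inner_conj_symm, hφ,
    inner_conj_symm]

theorem inner_const_mulOp (φ : Lp ℂ ∞ m) (f : Lp ℂ 2 m) :
    inner ℂ (Lp.const 2 m 1) (mulOp φ f) = inner ℂ (star f) (mulOp φ (Lp.const 2 m 1)) := by
  rw [L2.inner_def, L2.inner_def]
  refine integral_congr_ae ?_
  filter_upwards [mulOp_ae φ f, mulOp_ae φ (Lp.const 2 m 1), Lp.coeFn_star f,
    Lp.coeFn_const (p := 2) m (1 : ℂ)] with y h1 h2 h3 h4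
  rw [h1, h2, h3, h4, Pi.star_apply, Function.const_apply, RCLike.inner_apply, RCLike.inner_apply,
    map_one, star_def, conj_conj, mul_one, mul_one]

end Lp

section Embedding

variable {X ι H : Type*} [MeasurableSpace X] (μ : Measure X) [IsProbabilityMeasure μ]

variable (ι) in
/-- The isometry `f ↦ 1 ⊗ f` from `L²(X)` to `L²(Z × X)`. -/
noncomputable def sndEmb : Lp ℂ 2 μ →ₗᵢ[ℂ] Lp ℂ 2 ((gaussMeasure ι).prod μ) :=
  Lp.compMeasurePreservingₗᵢ ℂ Prod.snd measurePreserving_snd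

theorem sndEmb_ae (f : Lp ℂ 2 μ) :
    sndEmb ι μ f =ᵐ[(gaussMeasure ι).prod μ] fun p => f p.2 :=
  Lp.coeFn_compMeasurePreserving f measurePreserving_snd

theorem sndEmb_const (c : ℂ) :
    sndEmb ι μ (Lp.const 2 μ c) = Lp.const 2 ((gaussMeasure ι).prod μ) c :=
  compMeasurePreserving_const measurePreserving_snd c

theorem mulOp_liftX_sndEmb (a : Lp ℂ ∞ μ) (f : Lp ℂ 2 μ) :
    mulOp (liftX ι μ a) (sndEmb ι μ f) = sndEmb ι μ (mulOp a f) :=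
  mulOp_compMeasurePreserving measurePreserving_snd a f

theorem star_mem_range_mulOp_liftX : ∀ s ∈ Set.range fun a => mulOp (liftX ι μ a),
    star s ∈ Set.range fun a => mulOp (liftX ι μ a) := by
  rintro _ ⟨a, rfl⟩
  refine ⟨star a, ?_⟩
  change mulOp (liftX ι μ (star a)) = star (mulOp (liftX ι μ a))
  rw [star_mulOp, liftX, liftX, star_compMeasurePreserving]

theorem mulOp_mem_commutant_oneTensorAlgebra (φ : Lp ℂ ∞ ((gaussMeasure ι).prod μ)) :
    mulOp φ ∈ (oneTensorAlgebra ι μ).commutant := by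
  refine (mem_commutant_generatedVN (star_mem_range_mulOp_liftX μ)).2 ?_
  rintro _ ⟨a, rfl⟩
  exact mulOp_comm _ φ

instance : (sndEmb ι μ).toLinearMap.range.HasOrthogonalProjection :=
  have : CompleteSpace (sndEmb ι μ).toLinearMap.range :=
    (sndEmb ι μ).isometry.isUniformInducing.isComplete_range.completeSpace_coe
  inferInstance

theorem starProjection_range_sndEmb_mem_commutant :
    (sndEmb ι μ).toLinearMap.range.starProjection ∈ (oneTensorAlgebra ι μ).commutant := by
  refine starProjection_mem_commutant_generatedVN (star_mem_range_mulOp_liftX μ) _ ?_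
  rintro _ ⟨a, rfl⟩ _ ⟨f, rfl⟩
  exact ⟨mulOp a f, (mulOp_liftX_sndEmb μ a f).symm⟩

variable [NormedAddCommGroup H] [InnerProductSpace ℝ H] (e : HilbertBasis ι ℝ H)

theorem integral_omegaFun (ξ : H) :
    ∫ z, omegaFun e ξ z ∂(gaussMeasure ι) = Real.exp (-‖ξ‖ ^ 2) := by
  have h := integral_exp_gaussField e (Real.sqrt 2 • ξ)
  rw [norm_smul, mul_pow, Real.norm_eq_abs, sq_abs, Real.sq_sqrt zero_le_two] at h
  rw [show -‖ξ‖ ^ 2 = -(2 * ‖ξ‖ ^ 2) / 2 by ring, ← h]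
  refine integral_congr_ae ?_
  rw [map_smul]
  filter_upwards [Lp.coeFn_smul (Real.sqrt 2) (gaussField e ξ)] with z hz
  rw [hz, Pi.smul_apply, smul_eq_mul, omegaFun, ofReal_mul]
  ring_nf

theorem inner_sndEmb_omegaOp_sndEmb [Countable ι] (ξ : H) (f f' : Lp ℂ 2 μ) :
    inner ℂ (sndEmb ι μ f) (omegaOp μ e ξ (sndEmb ι μ f')) =
      Real.exp (-‖ξ‖ ^ 2) * inner ℂ f f' := by
  rw [L2.inner_def, L2.inner_def, ← integral_omegaFun e ξ, ← integral_prod_mul]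
  refine integral_congr_ae ?_
  filter_upwards [omegaOp_ae μ e ξ (sndEmb ι μ f'), sndEmb_ae (ι := ι) μ f,
    sndEmb_ae (ι := ι) μ f'] with p h1 h2 h3
  rw [h1, h2, h3, RCLike.inner_apply, RCLike.inner_apply, mul_assoc]

end Embedding

section Deformation

variable {Γ X ι H : Type*} [Group Γ] [MeasurableSpace X] {μ : Measure X} [IsProbabilityMeasure μ]

theorem vacuum_eq_single [DecidableEq Γ] :
    vacuum Γ ι μ = lp.single 2 1 (Lp.const 2 ((gaussMeasure ι).prod μ) 1) := by
  unfold vacuum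
  congr!

theorem tau_mul (x y : HilbertK Γ ι μ →L[ℂ] HilbertK Γ ι μ) :
    tau (x * y) = inner ℂ (star x (vacuum Γ ι μ)) (y (vacuum Γ ι μ)) := by
  rw [ContinuousLinearMap.star_eq_adjoint, ContinuousLinearMap.adjoint_inner_left]
  rfl

theorem twoNorm_eq_norm (x : HilbertK Γ ι μ →L[ℂ] HilbertK Γ ι μ) :
    twoNorm x = ‖x (vacuum Γ ι μ)‖ := by
  rw [twoNorm, tau_mul, star_star, ← RCLike.re_eq_complex_re, inner_self_eq_norm_sq,
    Real.sqrt_sq (norm_nonneg _)]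

section Damping

variable [NormedAddCommGroup H] [NormedSpace ℝ H]

/-- The contraction of `ℓ²(Γ, L²(Z × X))` that multiplies the `g`-th component by
`exp(-‖t b(g⁻¹)‖² / 2)`. Its square is the compression of the unitary implementing `α_t` to
`ℓ²(Γ, 1 ⊗ L²(X))`. -/
noncomputable def damping (μ : Measure X) [IsProbabilityMeasure μ] (ι : Type*) (b : Γ → H) (t : ℝ) :
    HilbertK Γ ι μ →L[ℂ] HilbertK Γ ι μ :=
  diagOp (fun g => (Real.exp (-‖t • b g⁻¹‖ ^ 2 / 2) : ℂ) • 1) 1 fun g => by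
    refine (norm_smul_le _ _).trans (mul_le_one₀ ?_ (norm_nonneg _)
      ContinuousLinearMap.norm_id_le)
    rw [norm_real, Real.norm_eq_abs, Real.abs_exp, Real.exp_le_one_iff, neg_div]
    exact neg_nonpos.2 (by positivity)

theorem damping_apply (b : Γ → H) (t : ℝ) (f : HilbertK Γ ι μ) (g : Γ) :
    damping μ ι b t f g = (Real.exp (-‖t • b g⁻¹‖ ^ 2 / 2) : ℂ) • f g := rfl

theorem norm_damping_apply_le (b : Γ → H) (t : ℝ) (f : HilbertK Γ ι μ) :
    ‖damping μ ι b t f‖ ≤ ‖f‖ := by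
  simpa only [NNReal.coe_one, one_mul] using
    (damping μ ι b t).le_of_opNorm_le (norm_diagOp_le _ _ _) f

theorem inner_damping_apply (b : Γ → H) (t : ℝ) (f f' : HilbertK Γ ι μ) (g : Γ) :
    inner ℂ (damping μ ι b t f g) (damping μ ι b t f' g) =
      Real.exp (-‖t • b g⁻¹‖ ^ 2) * inner ℂ (f g) (f' g) := by
  rw [damping_apply, damping_apply, inner_smul_left, inner_smul_right, conj_ofReal, ← mul_assoc,
    ← ofReal_mul, ← Real.exp_add, add_halves]

end Damping

variable [NormedAddCommGroup H] [InnerProductSpace ℝ H] [Countable ι] {e : HilbertBasis ι ℝ H}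
  {π : Γ →* (H ≃ₗᵢ[ℝ] H)} {b : Γ → H}

theorem IsOneCocycle.apply_one (hb : IsOneCocycle π b) : b 1 = 0 := by
  have h := hb 1 1
  rw [mul_one, map_one] at h
  exact left_eq_add.1 h

variable (e) in
theorem deformationUnitary_vacuum (hb : b 1 = 0) (t : ℝ) :
    deformationUnitary μ e b t (vacuum Γ ι μ) = vacuum Γ ι μ := by
  classical
  rw [vacuum_eq_single, deformationUnitary, diagOp_single, inv_one, hb, smul_zero, neg_zero,
    omegaOp_zero, one_apply_eq_self]

variable [MulAction Γ X] [MeasurableConstSMul Γ X] [SMulInvariantMeasure Γ X μ]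

theorem conj_mem_oneTensorAlgebra (g : Γ) :
    ∀ x ∈ oneTensorAlgebra ι μ,
      (diagonalRep μ e π g).conjStarAlgEquiv x ∈ oneTensorAlgebra ι μ := by
  refine fun x hx => conjStarAlgEquiv_mem_generatedVN ?_ hx
  rintro _ ⟨a, rfl⟩
  exact subset_generatedVN _ ⟨_, (conj_liftX μ e π g a).symm⟩

theorem diagonalRep_const (g : Γ) (c : ℂ) :
    diagonalRep μ e π g (Lp.const 2 ((gaussMeasure ι).prod μ) c) = Lp.const 2 _ c :=
  compMeasurePreserving_const (measurePreserving_diagonalMap μ e π g) c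

variable {x z : HilbertK Γ ι μ →L[ℂ] HilbertK Γ ι μ}

theorem exists_sndEmb_of_mem_Msub (hx : x ∈ Msub μ e π) (g : Γ) :
    ∃ f, sndEmb ι μ f = x (vacuum Γ ι μ) g := by
  classical
  have hfix := Submodule.starProjection_eq_self_iff.2
    (LinearMap.mem_range_self (sndEmb ι μ).toLinearMap (Lp.const 2 μ 1))
  rw [LinearIsometry.coe_toLinearMap, sndEmb_const] at hfix
  rw [vacuum_eq_single]
  exact Submodule.starProjection_eq_self_iff.1 (apply_single_of_fixed conj_mem_oneTensorAlgebra hx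
    (starProjection_range_sndEmb_mem_commutant μ) hfix g 1)

theorem star_apply_vacuum (hx : x ∈ Msub μ e π) (g : Γ) :
    star x (vacuum Γ ι μ) g = star (diagonalRep μ e π g⁻¹ (x (vacuum Γ ι μ) g⁻¹)) := by
  classical
  refine ext_inner_mulOp_const fun φ => ?_
  rw [vacuum_eq_single, inner_star_apply_single conj_mem_oneTensorAlgebra hx
    (mulOp_mem_commutant_oneTensorAlgebra μ φ) (fun g => diagonalRep_const g 1), inner_const_mulOp]

theorem norm_star_apply_vacuum (hx : x ∈ Msub μ e π) :
    ‖star x (vacuum Γ ι μ)‖ = ‖x (vacuum Γ ι μ)‖ := by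
  have hnorm : ∀ g, ‖star x (vacuum Γ ι μ) g⁻¹‖ = ‖x (vacuum Γ ι μ) g‖ := fun g => by
    rw [star_apply_vacuum hx, norm_star_Lp, LinearIsometryEquiv.norm_map, inv_inv]
  have hp : 0 < (2 : ℝ≥0∞).toReal := by norm_num
  rw [lp.norm_eq_tsum_rpow hp, lp.norm_eq_tsum_rpow hp, ← (Equiv.inv Γ).tsum_eq]
  simp only [Equiv.inv_apply, hnorm]

theorem tau_conj_deformationUnitary_mul (hb : b 1 = 0) (t : ℝ) (hx : x ∈ Msub μ e π)
    (hz : z ∈ Msub μ e π) :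
    tau (deformationUnitary μ e b t * x * star (deformationUnitary μ e b t) * z) =
      inner ℂ (damping μ ι b t (star x (vacuum Γ ι μ))) (damping μ ι b t (z (vacuum Γ ι μ))) := by
  set v := vacuum Γ ι μ
  set W := deformationUnitary μ e b t
  have hW : star W = deformationUnitary μ e b (-t) := star_deformationUnitary μ e b t
  calc tau (W * x * star W * z)
      = tau (W * x * (star W * z)) := by rw [mul_assoc]
    _ = inner ℂ (star x (star W v)) (star W (z v)) := by rw [tau_mul, star_mul]; rfl
    _ = inner ℂ (star x v) (star W (z v)) := by rw [hW, deformationUnitary_vacuum e hb]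
    _ = inner ℂ (damping μ ι b t (star x v)) (damping μ ι b t (z v)) := by
        rw [lp.inner_eq_tsum, lp.inner_eq_tsum]
        refine tsum_congr fun g => ?_
        obtain ⟨f, hf⟩ := exists_sndEmb_of_mem_Msub (star_mem hx) g
        obtain ⟨f', hf'⟩ := exists_sndEmb_of_mem_Msub hz g
        rw [inner_damping_apply, hW, deformationUnitary, diagOp_apply, ← hf, ← hf',
          inner_sndEmb_omegaOp_sndEmb, LinearIsometry.inner_map_map, neg_smul, neg_neg]

theorem IsCondExp.twoNorm_le {y : HilbertK Γ ι μ →L[ℂ] HilbertK Γ ι μ} (hb : b 1 = 0) (t : ℝ)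
    (hx : x ∈ Msub μ e π)
    (hy : IsCondExp (Msub μ e π)
      (deformationUnitary μ e b t * x * star (deformationUnitary μ e b t)) y) :
    twoNorm y ≤ ‖damping μ ι b t (star x (vacuum Γ ι μ))‖ := by
  set η := star x (vacuum Γ ι μ)
  set ζ := star y (vacuum Γ ι μ)
  have hinner : inner ℂ ζ ζ = inner ℂ (damping μ ι b t η) (damping μ ι b t ζ) := by
    rw [← tau_mul, hy.2 _ (star_mem hy.1), tau_conj_deformationUnitary_mul hb t hx (star_mem hy.1)]
  rw [twoNorm_eq_norm, ← norm_star_apply_vacuum hy.1]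
  have hle : ‖ζ‖ * ‖ζ‖ ≤ ‖damping μ ι b t η‖ * ‖ζ‖ :=
    calc ‖ζ‖ * ‖ζ‖ = RCLike.re (inner ℂ (damping μ ι b t η) (damping μ ι b t ζ)) := by
          rw [← hinner, inner_self_eq_norm_mul_norm]
      _ ≤ ‖damping μ ι b t η‖ * ‖damping μ ι b t ζ‖ := re_inner_le_norm _ _
      _ ≤ ‖damping μ ι b t η‖ * ‖ζ‖ := by gcongr; exact norm_damping_apply_le b t ζ
  rcases (norm_nonneg ζ).eq_or_lt with hζ | hζ
  · rw [← hζ]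
    exact norm_nonneg _
  · exact le_of_mul_le_mul_right hle hζ

theorem twoNorm_condExp_conj_deformationUnitary_le (hb : b 1 = 0) (t : ℝ) (hx : x ∈ Msub μ e π) :
    twoNorm (condExp (Msub μ e π)
        (deformationUnitary μ e b t * x * star (deformationUnitary μ e b t))) ≤
      ‖damping μ ι b t (star x (vacuum Γ ι μ))‖ := by
  unfold condExp
  split_ifs with h
  · exact h.choose_spec.twoNorm_le hb t hx
  · rw [twoNorm_eq_norm, zero_apply, norm_zero]
    exact norm_nonneg _

theorem coe_deformation (hb : IsOneCocycle π b) (t : ℝ) (x : (Mtilde μ e π).toStarSubalgebra) :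
    (deformation μ e π hb t x : HilbertK Γ ι μ →L[ℂ] HilbertK Γ ι μ) =
      deformationUnitary μ e b t * x * star (deformationUnitary μ e b t) := rfl

end Deformation

end CocycleDeformation

open MeasureTheory CocycleDeformation in
theorem lemma3p4 {Γ X ι H : Type*} [Group Γ]
    [MeasurableSpace X] [MulAction Γ X] [MeasurableConstSMul Γ X]
    (μ : Measure X) [IsProbabilityMeasure μ] [SMulInvariantMeasure Γ X μ]
    [Countable ι] [NormedAddCommGroup H] [InnerProductSpace ℝ H]
    (e : HilbertBasis ι ℝ H) (π : Γ →* (H ≃ₗᵢ[ℝ] H)) (b : Γ → H) (hb : IsOneCocycle π b)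
    (t : ℝ) (x : (Mtilde μ e π).toStarSubalgebra)
    (hx : (x : HilbertK Γ ι μ →L[ℂ] HilbertK Γ ι μ) ∈ Msub μ e π) :
    (tau ((deformation μ e π hb t x : HilbertK Γ ι μ →L[ℂ] HilbertK Γ ι μ) *
          star (x : HilbertK Γ ι μ →L[ℂ] HilbertK Γ ι μ))).im = 0 ∧
      twoNorm (condExp (Msub μ e π) (deformation μ e π hb t x)) ^ 2 ≤
        (tau ((deformation μ e π hb t x : HilbertK Γ ι μ →L[ℂ] HilbertK Γ ι μ) *
          star (x : HilbertK Γ ι μ →L[ℂ] HilbertK Γ ι μ))).re := by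
  rw [coe_deformation, tau_conj_deformationUnitary_mul hb.apply_one t hx (star_mem hx),
    inner_self_eq_norm_sq_to_K]
  norm_cast
  refine ⟨rfl, pow_le_pow_left₀ ?_ (twoNorm_condExp_conj_deformationUnitary_le hb.apply_one t hx) 2⟩
  rw [twoNorm_eq_norm]
  exact norm_nonneg _
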